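/- **Conventions.** Fix a universe; "small" refers to it. A *Reedy category* is a small category $A$ with two wide subcategories $A^{\to}$ (direct) and $A^{\leftarrow}$ (inverse), such that for some function from the objects of $A$ to the ordinals every nonidentity morphism of $A^{\to}$ strictly raises the degree and every nonidentity morphism of $A^{\leftarrow}$ strictly lowers it, and such that every morphism of $A$ factors uniquely as a morphism of $A^{\leftarrow}$ followed by a morphism of $A^{\to}$. A *morphism of Reedy categories* $f:A\to B$ is a functor that restricts to functors $f^{\to}:A^{\to}\to B^{\to}$ and $f^{\leftarrow}:A^{\leftarrow}\to B^{\leftarrow}$. For an object $c$ of a category $C$, $\partial(C/c)\subseteq C/c$ and $\partial(c/C)\subseteq c/C$ denote the full subcategories of the slice categories on the nonidentity morphisms to $c$, respectively from $c$. Let $M$ be a model category with small hom-sets and all small limits and colimits. In the *Reedy model structure* on the category $M^A$ of functors $A\to M$, a morphism $X\to Y$ is * a weak equivalence if every $X_\alpha\to Y_\alpha$ is one in $M$; * a cofibration if for every object $\alpha$ the morphism $X_\alpha\amalg_{L_\alpha X}L_\alpha Y\to Y_\alpha$ is one in $M$, where $L_\alpha X=\operatorname{colim}_{\partial(A^{\to}/\alpha)}X$;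 * a fibration if for every object $\alpha$ the morphism $X_\alpha\to M^\alpha X\times_{M^\alpha Y}Y_\alpha$ is one in $M$, where $M^\alpha X=\lim_{\partial(\alpha/A^{\leftarrow})}X$. An adjunction is a *Quillen adjunction* if the left adjoint preserves cofibrations and trivial cofibrations and the right adjoint preserves fibrations and trivial fibrations. Write $f^{*}:M^B\to M^A$ for composition with $f$, and $f_!$ and $f_*$ for left and right Kan extension along $f$. A morphism $f$ is a *left fibration* if for every such $M$ the adjunction $f_!\dashv f^{*}$ between $M^A$ and $M^B$ with their Reedy model structures is a Quillen adjunction, and a *right fibration* if for every such $M$ the adjunction $f^{*}\dashv f_*$ is one. For an object $\beta$ of $B$, $f^{\leftarrow}/\beta$ is the comma category of pairs $(\gamma,\ f(\gamma)\to\beta)$ with $\gamma$ an object of $A^{\leftarrow}$ and the morphism in $B^{\leftarrow}$. A morphism $\sigma:f(\alpha)\to\beta$ of $B^{\leftarrow}$ is an object of it, and $\partial(\alpha/(f^{\leftarrow}/\beta))$ denotes $\partial(c/C)$ for $C=f^{\leftarrow}/\beta$ and $c=(\alpha,\sigma)$. Dually, $\beta/f^{\to}$ is the comma category of pairs $(\gamma,\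 \beta\to f(\gamma))$ with the morphism in $B^{\to}$, and for $\sigma:\beta\to f(\alpha)$ in $B^{\to}$, $\partial((\beta/f^{\to})/\alpha)$ denotes $\partial(C/c)$ for $C=\beta/f^{\to}$ and $c=(\alpha,\sigma)$. **Theorem.** Let $f:A\to B$ be a morphism of Reedy categories. 1. $f$ is a left fibration if and only if, for every object $\alpha$ of $A$, every object $\beta$ of $B$ and every morphism $f(\alpha)\to\beta$ of $B^{\leftarrow}$, the nerve of $\partial(\alpha/(f^{\leftarrow}/\beta))$ is either empty or connected. 2. $f$ is a right fibration if and only if, for every object $\alpha$ of $A$, every object $\beta$ of $B$ and every morphism $\beta\to f(\alpha)$ of $B^{\to}$, the nerve of $\partial((\beta/f^{\to})/\alpha)$ is either empty or connected. -/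

import Mathlib

open CategoryTheory CategoryTheory.Limits HomotopicalAlgebra

universe u w

/-- A small category with a Reedy structure: two wide (lluf) subcategories, the inverse one and
the direct one, such that for some degree function with ordinal values the nonidentity morphisms
of the inverse subcategory lower the degree, those of the direct subcategory raise it, and every
morphism factors uniquely as a morphism of the inverse subcategory followed by a morphism of the
direct one. -/
class ReedyCategory (A : Type w) [SmallCategory A] where
  invHoms : MorphismProperty A
  dirHoms : MorphismProperty A
  [inv_isMultiplicative : invHoms.IsMultiplicative]
  [dir_isMultiplicative : dirHoms.IsMultiplicative]
  nonempty_reedyStructure : Nonempty (ReedyStructure invHoms dirHoms Ordinal.{w})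

namespace ReedyCategory

attribute [instance] inv_isMultiplicative dir_isMultiplicative

/-- The inverse subcategory of a Reedy category. -/
abbrev InvCat (A : Type w) [SmallCategory A] [ReedyCategory A] : Type w :=
  WideSubcategory (invHoms : MorphismProperty A)

/-- The direct subcategory of a Reedy category. -/
abbrev DirCat (A : Type w) [SmallCategory A] [ReedyCategory A] : Type w :=
  WideSubcategory (dirHoms : MorphismProperty A)

/-- The inclusion of the inverse subcategory. -/
abbrev invInclusion (A : Type w) [SmallCategory A] [ReedyCategory A] : InvCat A ⥤ A :=
  wideSubcategoryInclusion _

/-- The inclusion of the direct subcategory. -/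
abbrev dirInclusion (A : Type w) [SmallCategory A] [ReedyCategory A] : DirCat A ⥤ A :=
  wideSubcategoryInclusion _

end ReedyCategory

open ReedyCategory

/-- A morphism of Reedy categories: a functor that restricts to the inverse subcategories and to
the direct subcategories. -/
structure ReedyMorphism (A B : Type w) [SmallCategory A] [SmallCategory B]
    [ReedyCategory A] [ReedyCategory B] where
  functor : A ⥤ B
  map_inv {X Y : A} (g : X ⟶ Y) : invHoms g → invHoms (functor.map g)
  map_dir {X Y : A} (g : X ⟶ Y) : dirHoms g → dirHoms (functor.map g)

namespace ReedyMorphism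

variable {A B : Type w} [SmallCategory A] [SmallCategory B] [ReedyCategory A] [ReedyCategory B]

/-- The functor between inverse subcategories. -/
def invFunctor (f : ReedyMorphism A B) : InvCat A ⥤ InvCat B where
  obj X := ⟨f.functor.obj X.obj⟩
  map g := ⟨f.functor.map g.hom, f.map_inv _ g.property⟩
  map_id X := WideSubcategory.hom_ext _ (f.functor.map_id X.obj)
  map_comp g h := WideSubcategory.hom_ext _ (f.functor.map_comp g.hom h.hom)

/-- The functor between direct subcategories. -/
def dirFunctor (f : ReedyMorphism A B) : DirCat A ⥤ DirCat B where
  obj X := ⟨f.functor.obj X.obj⟩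
  map g := ⟨f.functor.map g.hom, f.map_dir _ g.property⟩
  map_id X := WideSubcategory.hom_ext _ (f.functor.map_id X.obj)
  map_comp g h := WideSubcategory.hom_ext _ (f.functor.map_comp g.hom h.hom)

end ReedyMorphism

section LatchingMatching

variable {C : Type w} [SmallCategory C]

/-- The latching category `∂(C/c)`: the full subcategory of the slice category `C/c` on the
nonidentity morphisms with target `c`. -/
abbrev LatchingCategory (c : C) : Type w :=
  ObjectProperty.FullSubcategory (fun x : Over c => ¬ MorphismProperty.identities C x.hom)

/-- The matching category `∂(c/C)`: the full subcategory of the slice category `c/C` on the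
nonidentity morphisms with source `c`. -/
abbrev MatchingCategory (c : C) : Type w :=
  ObjectProperty.FullSubcategory (fun x : Under c => ¬ MorphismProperty.identities C x.hom)

/-- The forgetful functor `∂(C/c) ⥤ C`. -/
abbrev latchingForget (c : C) : LatchingCategory c ⥤ C :=
  ObjectProperty.ι _ ⋙ Over.forget c

/-- The forgetful functor `∂(c/C) ⥤ C`. -/
abbrev matchingForget (c : C) : MatchingCategory c ⥤ C :=
  ObjectProperty.ι _ ⋙ Under.forget c

variable {M : Type u} [Category.{w} M]

section

variable [HasColimits M]

/-- The latching object `L_c X`. -/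
noncomputable abbrev latchingObj (X : C ⥤ M) (c : C) : M :=
  colimit (latchingForget c ⋙ X)

/-- The cocone with vertex `X c` over the diagram defining `L_c X`. -/
def latchingCocone (X : C ⥤ M) (c : C) : Cocone (latchingForget c ⋙ X) where
  pt := X.obj c
  ι :=
    { app := fun x => X.map x.obj.hom
      naturality := fun x y g => by simp [← Functor.map_comp] }

/-- The canonical morphism `L_c X ⟶ X c`. -/
noncomputable def latchingToObj (X : C ⥤ M) (c : C) : latchingObj X c ⟶ X.obj c :=
  colimit.desc (latchingForget c ⋙ X) (latchingCocone X c)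

lemma ι_latchingToObj (X : C ⥤ M) (c : C) (x : LatchingCategory c) :
    colimit.ι (latchingForget c ⋙ X) x ≫ latchingToObj X c = X.map x.obj.hom :=
  colimit.ι_desc _ _

/-- The morphism `L_c X ⟶ L_c Y` induced by `φ : X ⟶ Y`. -/
noncomputable def latchingMap {X Y : C ⥤ M} (φ : X ⟶ Y) (c : C) :
    latchingObj X c ⟶ latchingObj Y c :=
  colimMap (Functor.whiskerLeft (latchingForget c) φ)

lemma latching_comm {X Y : C ⥤ M} (φ : X ⟶ Y) (c : C) :
    latchingToObj X c ≫ φ.app c = latchingMap φ c ≫ latchingToObj Y c := by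
  apply colimit.hom_ext
  intro x
  rw [latchingMap, ι_colimMap_assoc, ι_latchingToObj, ← Category.assoc, ι_latchingToObj]
  exact φ.naturality x.obj.hom

/-- The relative latching morphism `X c ⨿_{L_c X} L_c Y ⟶ Y c` of `φ : X ⟶ Y`. -/
noncomputable def relativeLatchingMap {X Y : C ⥤ M} (φ : X ⟶ Y) (c : C) :
    pushout (latchingToObj X c) (latchingMap φ c) ⟶ Y.obj c :=
  pushout.desc (φ.app c) (latchingToObj Y c) (latching_comm φ c)

end

section

variable [HasLimits M]

/-- The matching object `M^c X`. -/
noncomputable abbrev matchingObj (X : C ⥤ M) (c : C) : M :=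
  limit (matchingForget c ⋙ X)

/-- The cone with vertex `X c` over the diagram defining `M^c X`. -/
def matchingCone (X : C ⥤ M) (c : C) : Cone (matchingForget c ⋙ X) where
  pt := X.obj c
  π :=
    { app := fun x => X.map x.obj.hom
      naturality := fun x y g => by simp [← Functor.map_comp] }

/-- The canonical morphism `X c ⟶ M^c X`. -/
noncomputable def objToMatching (X : C ⥤ M) (c : C) : X.obj c ⟶ matchingObj X c :=
  limit.lift (matchingForget c ⋙ X) (matchingCone X c)

lemma objToMatching_π (X : C ⥤ M) (c : C) (x : MatchingCategory c) :
    objToMatching X c ≫ limit.π (matchingForget c ⋙ X) x = X.map x.obj.hom :=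
  limit.lift_π _ _

/-- The morphism `M^c X ⟶ M^c Y` induced by `φ : X ⟶ Y`. -/
noncomputable def matchingMap {X Y : C ⥤ M} (φ : X ⟶ Y) (c : C) :
    matchingObj X c ⟶ matchingObj Y c :=
  limMap (Functor.whiskerLeft (matchingForget c) φ)

lemma matching_comm {X Y : C ⥤ M} (φ : X ⟶ Y) (c : C) :
    objToMatching X c ≫ matchingMap φ c = φ.app c ≫ objToMatching Y c := by
  apply limit.hom_ext
  intro x
  rw [Category.assoc, Category.assoc, matchingMap, limMap_π, objToMatching_π, ← Category.assoc,
    objToMatching_π]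
  exact φ.naturality x.obj.hom

/-- The relative matching morphism `X c ⟶ M^c X ×_{M^c Y} Y c` of `φ : X ⟶ Y`. -/
noncomputable def relativeMatchingMap {X Y : C ⥤ M} (φ : X ⟶ Y) (c : C) :
    X.obj c ⟶ pullback (matchingMap φ c) (objToMatching Y c) :=
  pullback.lift (objToMatching X c) (φ.app c) (matching_comm φ c)

end

end LatchingMatching

/-- Three classes of morphisms of a category, to serve as the cofibrations, fibrations and weak
equivalences of a model structure on it. -/
structure ModelClasses (C : Type*) [Category* C] where
  cof : MorphismProperty C
  fib : MorphismProperty C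
  weq : MorphismProperty C

/-- An adjunction `L ⊣ R` is a Quillen adjunction if `L` preserves cofibrations and trivial
cofibrations and `R` preserves fibrations and trivial fibrations. -/
structure IsQuillenAdjunction {C D : Type*} [Category* C] [Category* D]
    (S : ModelClasses C) (T : ModelClasses D) {L : C ⥤ D} {R : D ⥤ C} (_adj : L ⊣ R) : Prop where
  map_cof {X Y : C} (i : X ⟶ Y) : S.cof i → T.cof (L.map i)
  map_trivialCof {X Y : C} (i : X ⟶ Y) : S.cof i → S.weq i →
    T.cof (L.map i) ∧ T.weq (L.map i)
  map_fib {X Y : D} (p : X ⟶ Y) : T.fib p → S.fib (R.map p)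
  map_trivialFib {X Y : D} (p : X ⟶ Y) : T.fib p → T.weq p →
    S.fib (R.map p) ∧ S.weq (R.map p)

section Reedy

variable (A : Type w) [SmallCategory A] [ReedyCategory A]
variable (M : Type u) [Category.{w} M] [ModelCategory M] [HasLimits M] [HasColimits M]

/-- The Reedy model structure on the category of diagrams `A ⥤ M`: the weak equivalences are the
objectwise ones, the cofibrations are the morphisms whose restriction to the direct subcategory
has relative latching morphisms that are cofibrations, and the fibrations are the morphisms whose
restriction to the inverse subcategory has relative matching morphisms that are fibrations. -/
noncomputable def reedyModelClasses : ModelClasses (A ⥤ M) where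
  cof _ _ φ := ∀ a : DirCat A,
    cofibrations M (relativeLatchingMap (Functor.whiskerLeft (dirInclusion A) φ) a)
  fib _ _ φ := ∀ a : InvCat A,
    fibrations M (relativeMatchingMap (Functor.whiskerLeft (invInclusion A) φ) a)
  weq _ _ φ := ∀ a : A, weakEquivalences M (φ.app a)

end Reedy

section Fibrations

variable {A B : Type w} [SmallCategory A] [SmallCategory B] [ReedyCategory A] [ReedyCategory B]

/-- `f` is a left fibration if for every (locally small, complete and cocomplete) model category
`M` the adjunction `f_! ⊣ f^*`, with `f_!` the left Kan extension along `f` and `f^*` the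
composition with `f`, is a Quillen adjunction for the Reedy model structures. -/
def IsLeftFibration (f : ReedyMorphism A B) : Prop :=
  ∀ (M : Type (max u (w + 1))) [Category.{w} M] [ModelCategory M] [HasLimits M] [HasColimits M],
    IsQuillenAdjunction (reedyModelClasses A M) (reedyModelClasses B M)
      (f.functor.lanAdjunction M)

/-- `f` is a right fibration if for every (locally small, complete and cocomplete) model category
`M` the adjunction `f^* ⊣ f_*`, with `f_*` the right Kan extension along `f` and `f^*` the
composition with `f`, is a Quillen adjunction for the Reedy model structures. -/
def IsRightFibration (f : ReedyMorphism A B) : Prop :=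
  ∀ (M : Type (max u (w + 1))) [Category.{w} M] [ModelCategory M] [HasLimits M] [HasColimits M],
    IsQuillenAdjunction (reedyModelClasses B M) (reedyModelClasses A M)
      (f.functor.ranAdjunction M)

end Fibrations

/-- The nerve of `J` is either empty or connected. -/
def NerveEmptyOrConnected (J : Type w) [SmallCategory J] : Prop :=
  ¬ (nerve J).Nonempty ∨ (nerve J).IsConnected

/-! Everything is expressed through lifting properties. For a weak factorization system (L, R) on M,
call a map of diagrams Reedy right if its relative matching maps lift on the right against L, and
Reedy left if its relative latching maps lift on the left against R. Reedy left maps lift against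
Reedy right maps (`hasLiftingProperty_of_reedy`), and each class contains every map with the lifting
property against the other (`reedyLeft_of_hasLiftingProperty`, `reedyRight_of_hasLiftingProperty`).
The second fact is proved by testing against right Kan extensions from a slice category, so no Reedy
factorizations are needed. It follows that the adjunction of f_! and f^* is Quillen as soon as f^*
preserves Reedy right maps, and dually for f_*.

Matching data for f^*X at α prescribe maps V ⟶ X(f γ), one for each nonidentity inverse morphism α ⟶
γ. Composing with inverse morphisms f γ ⟶ β gives a map V ⟶ X β for each inverse σ : f α ⟶ β that
factors through the image of a nonidentity morphism. This map is independent of the factorization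
when the factorizations of σ form a connected category. What remains is an extension problem along a
cosieve of inverse morphisms out of f α, solved by induction on the degree (`exists_extension`,
`matchingLift_whiskerLeft_of_factorizationsConnected`).

Conversely, take an object E with distinct maps a, b : K ⟶ E that agree on a trivial cofibration N ⟶
K, and the cofree diagram E^{B(-, β)}. If the factorizations of σ fell into two components, using a
on one and b on the other would give matching data without a lift
(`factorizationsConnected_of_matchingLift`). Such an E exists for sets with injections as
cofibrations, surjections as fibrations and all maps as weak equivalences. Right fibrations are
handled by passing to opposite categories. -/

/-! ### Recursion on the degree, and lifting problems as compatible families -/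

/-- Dependent choice along a rank function with ordinal values. -/
theorem exists_forall_of_rank {ι : Type*} (rk : ι → Ordinal.{w}) {T : ι → Type*}
    (Good : ∀ i, (∀ j, rk j < rk i → T j) → T i → Prop)
    (step : ∀ i (l : ∀ j, rk j < rk i → T j),
      (∀ j (hj : rk j < rk i), Good j (fun k hk => l k (hk.trans hj)) (l j hj)) →
        ∃ t, Good i l t) :
    ∃ l : ∀ i, T i, ∀ i, Good i (fun j _ => l j) (l i) := by
  classical
  let wf : WellFounded (fun i j => rk i < rk j) := InvImage.wf rk wellFounded_lt
  -- `step` applies only to earlier values already known to be good, which plain recursion cannot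
  -- guarantee. The value `none` records a failure, and `key` shows that it never occurs.
  let body : ∀ i, (∀ j, rk j < rk i → Option (T j)) → Option (T i) := fun i F =>
    if h : ∃ (l : ∀ j, rk j < rk i → T j) (t : T i),
      (∀ j hj, F j hj = some (l j hj)) ∧ Good i l t then some h.choose_spec.choose else none
  let F : ∀ i, Option (T i) := wf.fix body
  have hF (i : ι) : F i = body i (fun j _ => F j) := wf.fix_eq body i
  have key (i : ι) : ∃ t, F i = some t ∧
      ∀ l : ∀ j, rk j < rk i → T j, (∀ j hj, F j = some (l j hj)) → Good i l t := by
    induction i using wf.induction with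
    | _ i ih =>
      choose l hl hg using ih
      obtain ⟨t, ht⟩ := step i l (fun j hj => hg j hj _ (fun k hk => hl k (hk.trans hj)))
      have h : ∃ (l : ∀ j, rk j < rk i → T j) (t : T i),
        (∀ j hj, F j = some (l j hj)) ∧ Good i l t := ⟨l, t, hl, ht⟩
      refine ⟨h.choose_spec.choose, ?_, fun l' hl' => ?_⟩
      · rw [hF]
        exact dif_pos h
      · have : l' = h.choose := by
          funext j hj
          have := (hl' j hj).symm.trans (h.choose_spec.choose_spec.1 j hj)
          exact Option.some.inj this
        rw [this]
        exact h.choose_spec.choose_spec.2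
  choose l hl hg using key
  exact ⟨l, fun i => hg i _ (fun j _ => hl j)⟩

/-- The nonidentity morphisms in a class of morphisms. -/
def nonIds {A : Type*} [Category* A] (W : MorphismProperty A) : MorphismProperty A :=
  fun _ _ g => W g ∧ ¬ MorphismProperty.identities A g

section

variable {A : Type*} [Category* A] {M : Type*} [Category* M]

/-- The lifting property of `i` against the relative matching morphism of `p` at `c`, spelled out
in terms of compatible families of morphisms. -/
def MatchingLift (W : MorphismProperty A) {X Y : A ⥤ M} (p : X ⟶ Y) (c : A) {U V : M}
    (i : U ⟶ V) : Prop :=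
  ∀ (u : U ⟶ X.obj c) (y : V ⟶ Y.obj c) (x : ∀ ⦃d : A⦄ (g : c ⟶ d), nonIds W g → (V ⟶ X.obj d)),
    i ≫ y = u ≫ p.app c →
    (∀ ⦃d : A⦄ (g : c ⟶ d) (hg : nonIds W g), i ≫ x g hg = u ≫ X.map g) →
    (∀ ⦃d : A⦄ (g : c ⟶ d) (hg : nonIds W g), x g hg ≫ p.app d = y ≫ Y.map g) →
    (∀ ⦃d e : A⦄ (g : c ⟶ d) (hg : nonIds W g) (h : d ⟶ e) (_ : W h) (hgh : nonIds W (g ≫ h)),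
      x g hg ≫ X.map h = x (g ≫ h) hgh) →
    ∃ l : V ⟶ X.obj c, i ≫ l = u ∧ l ≫ p.app c = y ∧
      ∀ ⦃d : A⦄ (g : c ⟶ d) (hg : nonIds W g), l ≫ X.map g = x g hg

/-- The lifting property of the relative latching morphism of `q` at `c` against `p`, spelled out
in terms of compatible families of morphisms. -/
def LatchingLift (W : MorphismProperty A) {X Y : A ⥤ M} (q : X ⟶ Y) (c : A) {E F : M}
    (p : E ⟶ F) : Prop :=
  ∀ (e : X.obj c ⟶ E) (y : Y.obj c ⟶ F) (x : ∀ ⦃d : A⦄ (g : d ⟶ c), nonIds W g → (Y.obj d ⟶ E)),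
    e ≫ p = q.app c ≫ y →
    (∀ ⦃d : A⦄ (g : d ⟶ c) (hg : nonIds W g), x g hg ≫ p = Y.map g ≫ y) →
    (∀ ⦃d : A⦄ (g : d ⟶ c) (hg : nonIds W g), q.app d ≫ x g hg = X.map g ≫ e) →
    (∀ ⦃d d' : A⦄ (g : d ⟶ c) (hg : nonIds W g) (h : d' ⟶ d) (_ : W h) (hgh : nonIds W (h ≫ g)),
      Y.map h ≫ x g hg = x (h ≫ g) hgh) →
    ∃ l : Y.obj c ⟶ E, l ≫ p = y ∧ q.app c ≫ l = e ∧
      ∀ ⦃d : A⦄ (g : d ⟶ c) (hg : nonIds W g), Y.map g ≫ l = x g hg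

/-- Extension of compatible families of morphisms `V ⟶ X d`, indexed by morphisms `c ⟶ d`, from a
cosieve `T` to a larger cosieve `S`. -/
theorem exists_extension (W : MorphismProperty A) [W.IsMultiplicative]
    (deg : A → Ordinal.{w}) (lt : ∀ ⦃a b : A⦄ (g : a ⟶ b), nonIds W g → deg b < deg a)
    {X Y : A ⥤ M} (p : X ⟶ Y) (c : A) {U V : M} (i : U ⟶ V)
    (S T : ∀ ⦃d : A⦄, (c ⟶ d) → Prop)
    (hS : ∀ ⦃d e : A⦄ (g : c ⟶ d) (h : d ⟶ e), S g → W h → S (g ≫ h))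
    (hT : ∀ ⦃d e : A⦄ (g : c ⟶ d) (h : d ⟶ e), T g → W h → T (g ≫ h))
    (hM : ∀ ⦃d : A⦄ (g : c ⟶ d), S g → ¬ T g → MatchingLift W p d i)
    (u : ∀ ⦃d : A⦄ (g : c ⟶ d), S g → (U ⟶ X.obj d))
    (y : ∀ ⦃d : A⦄ (g : c ⟶ d), S g → (V ⟶ Y.obj d))
    (x : ∀ ⦃d : A⦄ (g : c ⟶ d), T g → (V ⟶ X.obj d))
    (huy : ∀ ⦃d : A⦄ (g : c ⟶ d) (hg : S g), i ≫ y g hg = u g hg ≫ p.app d)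
    (hu : ∀ ⦃d e : A⦄ (g : c ⟶ d) (hg : S g) (h : d ⟶ e) (hh : W h),
      u g hg ≫ X.map h = u (g ≫ h) (hS g h hg hh))
    (hy : ∀ ⦃d e : A⦄ (g : c ⟶ d) (hg : S g) (h : d ⟶ e) (hh : W h),
      y g hg ≫ Y.map h = y (g ≫ h) (hS g h hg hh))
    (hx : ∀ ⦃d e : A⦄ (g : c ⟶ d) (hg : T g) (h : d ⟶ e) (hh : W h),
      x g hg ≫ X.map h = x (g ≫ h) (hT g h hg hh))
    (hxu : ∀ ⦃d : A⦄ (g : c ⟶ d) (hg : T g) (hg' : S g), i ≫ x g hg = u g hg')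
    (hxy : ∀ ⦃d : A⦄ (g : c ⟶ d) (hg : T g) (hg' : S g), x g hg ≫ p.app d = y g hg') :
    ∃ l : ∀ ⦃d : A⦄ (g : c ⟶ d), S g → (V ⟶ X.obj d),
      (∀ ⦃d : A⦄ (g : c ⟶ d) (hg : S g), i ≫ l g hg = u g hg) ∧
      (∀ ⦃d : A⦄ (g : c ⟶ d) (hg : S g), l g hg ≫ p.app d = y g hg) ∧
      (∀ ⦃d : A⦄ (g : c ⟶ d) (hg : S g) (hg' : T g), l g hg = x g hg') ∧
      (∀ ⦃d e : A⦄ (g : c ⟶ d) (hg : S g) (h : d ⟶ e) (hh : W h),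
        l g hg ≫ X.map h = l (g ≫ h) (hS g h hg hh)) := by
  let ι := Σ d : A, { g : c ⟶ d // S g }
  let rk : ι → Ordinal.{w} := fun z => deg z.1
  let Good : ∀ z : ι, (∀ z', rk z' < rk z → (V ⟶ X.obj z'.1)) → (V ⟶ X.obj z.1) → Prop :=
    fun z l t => i ≫ t = u z.2.1 z.2.2 ∧ t ≫ p.app z.1 = y z.2.1 z.2.2 ∧
      (∀ hg : T z.2.1, t = x z.2.1 hg) ∧
      ∀ ⦃e : A⦄ (h : z.1 ⟶ e) (hh : nonIds W h),
        t ≫ X.map h = l ⟨e, z.2.1 ≫ h, hS _ h z.2.2 hh.1⟩ (lt h hh)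
  obtain ⟨l, hl⟩ := exists_forall_of_rank rk Good (by
    rintro ⟨d, g, hg⟩ l hl
    have hl_congr : ∀ ⦃e : A⦄ (k k' : c ⟶ e) (hk : S k) (hk' : S k') (h : deg e < deg d), k = k' →
        l ⟨e, k, hk⟩ h = l ⟨e, k', hk'⟩ h := by
      rintro e k _ hk hk' h rfl
      rfl
    -- On `T` the value is prescribed; off `T` the values already chosen in lower degrees are the
    -- matching data of a lifting problem at `d`.
    by_cases hgT : T g
    · exact ⟨x g hgT, hxu _ _ _, hxy _ _ _, fun _ => rfl, fun e h hh => by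
        rw [(hl _ (lt h hh)).2.2.1 (hT g h hgT hh.1), hx g hgT h hh.1]⟩
    · obtain ⟨t, h1, h2, h3⟩ := hM g hg hgT (u g hg) (y g hg)
        (fun e h hh => l ⟨e, g ≫ h, hS _ h hg hh.1⟩ (lt h hh)) (huy g hg)
        (fun e h hh => by rw [(hl _ (lt h hh)).1, hu g hg h hh.1])
        (fun e h hh => by rw [(hl _ (lt h hh)).2.1, hy g hg h hh.1])
        (fun e e' h hh k hk hhk => by
          -- Compatibility is required for every `k` in `W`, but `Good` speaks only of nonidentity
          -- morphisms.
          by_cases hk' : MorphismProperty.identities A k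
          · obtain ⟨⟩ := hk'
            exact (congrArg _ (CategoryTheory.Functor.map_id _ _)).trans
              ((Category.comp_id _).trans (hl_congr _ _ _ _ (lt h hh) (by simp)))
          · exact ((hl ⟨e, g ≫ h, hS _ h hg hh.1⟩ (lt h hh)).2.2.2 k ⟨hk, hk'⟩).trans
              (hl_congr _ _ _ _ (lt (h ≫ k) hhk) (Category.assoc _ _ _)))
      exact ⟨t, h1, h2, fun h => (hgT h).elim, h3⟩)
  refine ⟨fun d g hg => l ⟨d, g, hg⟩, fun d g hg => (hl ⟨d, g, hg⟩).1,
    fun d g hg => (hl ⟨d, g, hg⟩).2.1, fun d g hg => (hl ⟨d, g, hg⟩).2.2.1,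
    fun d e g hg h hh => ?_⟩
  by_cases hh' : MorphismProperty.identities A h
  · obtain ⟨⟩ := hh'
    have hl_congr : ∀ (k k' : c ⟶ d) (hk : S k) (hk' : S k'), k = k' →
        l ⟨d, k, hk⟩ = l ⟨d, k', hk'⟩ := by
      rintro k _ hk hk' rfl
      rfl
    exact (congrArg _ (CategoryTheory.Functor.map_id _ _)).trans
      ((Category.comp_id _).trans (hl_congr _ _ _ _ (by simp)))
  · exact (hl ⟨d, g, hg⟩).2.2.2 h ⟨hh, hh'⟩

end

/-! ### Relative matching and latching maps in terms of compatible families -/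

section

variable {C : Type w} [SmallCategory C] {M : Type u} [Category.{w} M]

section

variable [HasLimits M] {X Y : C ⥤ M} (p : X ⟶ Y) {c : C}

/-- The projection from the matching object corresponding to a nonidentity morphism. -/
noncomputable def matchingProj (X : C ⥤ M) {d : C} (g : c ⟶ d) (hg : nonIds ⊤ g) :
    matchingObj X c ⟶ X.obj d :=
  limit.π (matchingForget c ⋙ X) ⟨Under.mk g, hg.2⟩

lemma matchingObj_hom_ext {V : M} {s t : V ⟶ matchingObj X c}
    (h : ∀ ⦃d : C⦄ (g : c ⟶ d) (hg : nonIds ⊤ g),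
      s ≫ matchingProj X g hg = t ≫ matchingProj X g hg) :
    s = t :=
  limit.hom_ext fun z => h z.obj.hom ⟨trivial, z.property⟩

lemma objToMatching_matchingProj {d : C} (g : c ⟶ d) (hg : nonIds ⊤ g) :
    objToMatching X c ≫ matchingProj X g hg = X.map g :=
  objToMatching_π X c _

lemma matchingMap_matchingProj {d : C} (g : c ⟶ d) (hg : nonIds ⊤ g) :
    matchingMap p c ≫ matchingProj Y g hg = matchingProj X g hg ≫ p.app d :=
  limMap_π _ _

lemma matchingProj_map {d e : C} (g : c ⟶ d) (hg : nonIds ⊤ g) (h : d ⟶ e)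
    (hgh : nonIds ⊤ (g ≫ h)) : matchingProj X g hg ≫ X.map h = matchingProj X (g ≫ h) hgh :=
  limit.w (matchingForget c ⋙ X) (ObjectProperty.homMk (Under.homMk h) :
    (⟨Under.mk g, hg.2⟩ : MatchingCategory c) ⟶ ⟨Under.mk (g ≫ h), hgh.2⟩)

lemma relativeMatchingMap_fst :
    relativeMatchingMap p c ≫ pullback.fst _ _ = objToMatching X c :=
  pullback.lift_fst _ _ _

lemma relativeMatchingMap_fst_assoc {Z : M} (k : matchingObj X c ⟶ Z) :
    relativeMatchingMap p c ≫ pullback.fst _ _ ≫ k = objToMatching X c ≫ k := by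
  rw [← relativeMatchingMap_fst p, Category.assoc]

lemma relativeMatchingMap_snd : relativeMatchingMap p c ≫ pullback.snd _ _ = p.app c :=
  pullback.lift_snd _ _ _

/-- A morphism to the matching object from a compatible family. -/
theorem exists_matchingObj_lift {V : M} (x : ∀ ⦃d : C⦄ (g : c ⟶ d), nonIds ⊤ g → (V ⟶ X.obj d))
    (hx : ∀ ⦃d e : C⦄ (g : c ⟶ d) (hg : nonIds ⊤ g) (h : d ⟶ e) (hgh : nonIds ⊤ (g ≫ h)),
      x g hg ≫ X.map h = x (g ≫ h) hgh) :
    ∃ t : V ⟶ matchingObj X c, ∀ ⦃d : C⦄ (g : c ⟶ d) (hg : nonIds ⊤ g),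
      t ≫ matchingProj X g hg = x g hg := by
  let s : Cone (matchingForget c ⋙ X) :=
    { pt := V
      π :=
        { app := fun z => x z.obj.hom ⟨trivial, z.property⟩
          naturality := fun z z' k => by
            have hk : z.obj.hom ≫ k.hom.right = z'.obj.hom := Under.w k.hom
            have := hx z.obj.hom ⟨trivial, z.property⟩ k.hom.right
              (by rw [hk]; exact ⟨trivial, z'.property⟩)
            simp only [hk] at this
            exact (Category.id_comp _).trans this.symm } }
  exact ⟨limit.lift _ s, fun d g hg => limit.lift_π s _⟩

/-- By the universal properties of the limit and of the pullback, the bottom edge of a square is a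
map to Y c together with a compatible family of maps to the X d. -/
theorem hasLiftingProperty_relativeMatchingMap_iff_top {U V : M} (i : U ⟶ V) :
    HasLiftingProperty i (relativeMatchingMap p c) ↔ MatchingLift ⊤ p c i := by
  constructor
  · intro H u y x h1 h2 h3 h4
    obtain ⟨t, ht⟩ := exists_matchingObj_lift x (fun _ _ g hg h => h4 g hg h trivial)
    have sq : CommSq u i (relativeMatchingMap p c) (pullback.lift t y (by
        apply matchingObj_hom_ext
        intro d g hg
        rw [Category.assoc, Category.assoc, matchingMap_matchingProj, objToMatching_matchingProj,
          ← Category.assoc, ht, h3])) := ⟨by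
      apply pullback.hom_ext
      · apply matchingObj_hom_ext
        intro d g hg
        simp only [Category.assoc, relativeMatchingMap_fst_assoc, pullback.lift_fst_assoc,
          objToMatching_matchingProj, ht, h2]
      · rw [Category.assoc, Category.assoc, relativeMatchingMap_snd, pullback.lift_snd, h1]⟩
    have : sq.HasLift := H.sq_hasLift sq
    have fac := sq.fac_right
    refine ⟨sq.lift, sq.fac_left, ?_, fun d g hg => ?_⟩
    · have := fac =≫ pullback.snd _ _
      rwa [Category.assoc, relativeMatchingMap_snd, pullback.lift_snd] at this
    · have := (fac =≫ pullback.fst _ _) =≫ matchingProj _ g hg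
      simpa only [Category.assoc, relativeMatchingMap_fst_assoc, pullback.lift_fst_assoc,
        objToMatching_matchingProj, ht] using this
  · intro H
    refine ⟨fun {u t} sq => ?_⟩
    have w := sq.w
    obtain ⟨l, h1, h2, h3⟩ := H u (t ≫ pullback.snd _ _)
      (fun d g hg => t ≫ pullback.fst _ _ ≫ matchingProj _ g hg)
      (by rw [← reassoc_of% w, relativeMatchingMap_snd])
      (fun d g hg => by
        rw [← reassoc_of% w, relativeMatchingMap_fst_assoc, objToMatching_matchingProj])
      (fun d g hg => by
        simp only [Category.assoc, ← matchingMap_matchingProj, pullback.condition_assoc,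
          objToMatching_matchingProj])
      (fun d e g hg h hh hgh => by
        rw [Category.assoc, Category.assoc, matchingProj_map])
    refine ⟨⟨⟨l, h1, ?_⟩⟩⟩
    apply pullback.hom_ext
    · apply matchingObj_hom_ext
      intro d g hg
      simp only [Category.assoc, relativeMatchingMap_fst_assoc, objToMatching_matchingProj]
      exact h3 g hg
    · rw [Category.assoc, relativeMatchingMap_snd]
      exact h2

end

section

variable [HasColimits M] {X Y : C ⥤ M} (q : X ⟶ Y) {c : C}

/-- The inclusion into the latching object corresponding to a nonidentity morphism. -/
noncomputable def latchingIncl (X : C ⥤ M) {d : C} (g : d ⟶ c) (hg : nonIds ⊤ g) :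
    X.obj d ⟶ latchingObj X c :=
  colimit.ι (latchingForget c ⋙ X) ⟨Over.mk g, hg.2⟩

lemma latchingObj_hom_ext {E : M} {s t : latchingObj X c ⟶ E}
    (h : ∀ ⦃d : C⦄ (g : d ⟶ c) (hg : nonIds ⊤ g),
      latchingIncl X g hg ≫ s = latchingIncl X g hg ≫ t) :
    s = t :=
  colimit.hom_ext fun z => h z.obj.hom ⟨trivial, z.property⟩

lemma latchingIncl_latchingToObj {d : C} (g : d ⟶ c) (hg : nonIds ⊤ g) :
    latchingIncl X g hg ≫ latchingToObj X c = X.map g :=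
  ι_latchingToObj X c _

lemma latchingIncl_latchingToObj_assoc {d : C} (g : d ⟶ c) (hg : nonIds ⊤ g) {Z : M}
    (k : X.obj c ⟶ Z) : latchingIncl X g hg ≫ latchingToObj X c ≫ k = X.map g ≫ k := by
  rw [← latchingIncl_latchingToObj g hg, Category.assoc]

lemma latchingIncl_latchingMap {d : C} (g : d ⟶ c) (hg : nonIds ⊤ g) :
    latchingIncl X g hg ≫ latchingMap q c = q.app d ≫ latchingIncl Y g hg :=
  ι_colimMap _ _

lemma latchingIncl_latchingMap_assoc {d : C} (g : d ⟶ c) (hg : nonIds ⊤ g) {Z : M}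
    (k : latchingObj Y c ⟶ Z) :
    latchingIncl X g hg ≫ latchingMap q c ≫ k = q.app d ≫ latchingIncl Y g hg ≫ k := by
  rw [← Category.assoc, latchingIncl_latchingMap, Category.assoc]

lemma map_latchingIncl {d d' : C} (g : d ⟶ c) (hg : nonIds ⊤ g) (h : d' ⟶ d)
    (hgh : nonIds ⊤ (h ≫ g)) : X.map h ≫ latchingIncl X g hg = latchingIncl X (h ≫ g) hgh :=
  colimit.w (latchingForget c ⋙ X) (ObjectProperty.homMk (Over.homMk h) :
    (⟨Over.mk (h ≫ g), hgh.2⟩ : LatchingCategory c) ⟶ ⟨Over.mk g, hg.2⟩)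

lemma map_latchingIncl_assoc {d d' : C} (g : d ⟶ c) (hg : nonIds ⊤ g) (h : d' ⟶ d)
    (hgh : nonIds ⊤ (h ≫ g)) {Z : M} (k : latchingObj X c ⟶ Z) :
    X.map h ≫ latchingIncl X g hg ≫ k = latchingIncl X (h ≫ g) hgh ≫ k := by
  rw [← map_latchingIncl g hg h hgh, Category.assoc]

lemma inl_relativeLatchingMap :
    pushout.inl _ _ ≫ relativeLatchingMap q c = q.app c :=
  pushout.inl_desc _ _ _

lemma inl_relativeLatchingMap_assoc {Z : M} (k : Y.obj c ⟶ Z) :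
    pushout.inl _ _ ≫ relativeLatchingMap q c ≫ k = q.app c ≫ k := by
  rw [← inl_relativeLatchingMap q, Category.assoc]

lemma inr_relativeLatchingMap :
    pushout.inr _ _ ≫ relativeLatchingMap q c = latchingToObj Y c :=
  pushout.inr_desc _ _ _

lemma inr_relativeLatchingMap_assoc {Z : M} (k : Y.obj c ⟶ Z) :
    pushout.inr _ _ ≫ relativeLatchingMap q c ≫ k = latchingToObj Y c ≫ k := by
  rw [← inr_relativeLatchingMap q, Category.assoc]

/-- A morphism from the latching object from a compatible family. -/
theorem exists_latchingObj_desc {E : M} (x : ∀ ⦃d : C⦄ (g : d ⟶ c), nonIds ⊤ g → (Y.obj d ⟶ E))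
    (hx : ∀ ⦃d d' : C⦄ (g : d ⟶ c) (hg : nonIds ⊤ g) (h : d' ⟶ d) (hgh : nonIds ⊤ (h ≫ g)),
      Y.map h ≫ x g hg = x (h ≫ g) hgh) :
    ∃ t : latchingObj Y c ⟶ E, ∀ ⦃d : C⦄ (g : d ⟶ c) (hg : nonIds ⊤ g),
      latchingIncl Y g hg ≫ t = x g hg := by
  let s : Cocone (latchingForget c ⋙ Y) :=
    { pt := E
      ι :=
        { app := fun z => x z.obj.hom ⟨trivial, z.property⟩
          naturality := fun z' z k => by
            have hk : k.hom.left ≫ z.obj.hom = z'.obj.hom := Over.w k.hom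
            have := hx z.obj.hom ⟨trivial, z.property⟩ k.hom.left
              (by rw [hk]; exact ⟨trivial, z'.property⟩)
            simp only [hk] at this
            exact this.trans (Category.comp_id _).symm } }
  exact ⟨colimit.desc _ s, fun d g hg => colimit.ι_desc s _⟩

theorem hasLiftingProperty_relativeLatchingMap_iff_top {E F : M} (p : E ⟶ F) :
    HasLiftingProperty (relativeLatchingMap q c) p ↔ LatchingLift ⊤ q c p := by
  constructor
  · intro H e y x h1 h2 h3 h4
    obtain ⟨t, ht⟩ := exists_latchingObj_desc x (fun _ _ g hg h => h4 g hg h trivial)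
    have sq : CommSq (pushout.desc e t (by
        apply latchingObj_hom_ext
        intro d g hg
        rw [latchingIncl_latchingMap_assoc, latchingIncl_latchingToObj_assoc, ht, h3]))
        (relativeLatchingMap q c) p y := ⟨by
      apply pushout.hom_ext
      · rw [inl_relativeLatchingMap_assoc, pushout.inl_desc_assoc, h1]
      · apply latchingObj_hom_ext
        intro d g hg
        rw [inr_relativeLatchingMap_assoc, pushout.inr_desc_assoc, reassoc_of% (ht g hg),
          latchingIncl_latchingToObj_assoc, h2]⟩
    have : sq.HasLift := H.sq_hasLift sq
    have fac := sq.fac_left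
    refine ⟨sq.lift, sq.fac_right, ?_, fun d g hg => ?_⟩
    · have := pushout.inl _ _ ≫= fac
      rwa [inl_relativeLatchingMap_assoc, pushout.inl_desc] at this
    · have := latchingIncl _ g hg ≫= (pushout.inr _ _ ≫= fac)
      rwa [inr_relativeLatchingMap_assoc, pushout.inr_desc, latchingIncl_latchingToObj_assoc,
        ht] at this
  · intro H
    refine ⟨fun {t y} sq => ?_⟩
    have w := sq.w
    obtain ⟨l, h1, h2, h3⟩ := H (pushout.inl _ _ ≫ t) y
      (fun d g hg => latchingIncl _ g hg ≫ pushout.inr _ _ ≫ t)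
      (by rw [Category.assoc, w, inl_relativeLatchingMap_assoc])
      (fun d g hg => by
        rw [Category.assoc, Category.assoc, w, inr_relativeLatchingMap_assoc,
          latchingIncl_latchingToObj_assoc])
      (fun d g hg => by
        rw [← latchingIncl_latchingMap_assoc, ← pushout.condition_assoc,
          latchingIncl_latchingToObj_assoc])
      (fun d e g hg h hh hgh => by
        rw [map_latchingIncl_assoc])
    refine ⟨⟨⟨l, ?_, h1⟩⟩⟩
    apply pushout.hom_ext
    · rw [inl_relativeLatchingMap_assoc, h2]
    · apply latchingObj_hom_ext
      intro d g hg
      rw [inr_relativeLatchingMap_assoc, latchingIncl_latchingToObj_assoc, h3]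

end

section

variable (W : MorphismProperty C) [W.IsMultiplicative]

lemma WideSubcategory.identities_iff {c d : WideSubcategory W} (g : c ⟶ d) :
    MorphismProperty.identities _ g ↔ MorphismProperty.identities C g.hom := by
  obtain ⟨c⟩ := c
  obtain ⟨d⟩ := d
  obtain ⟨g, hg⟩ := g
  constructor
  · rintro ⟨_⟩
    exact ⟨_⟩
  · intro h
    change c ⟶ d at g
    change MorphismProperty.identities C g at h
    obtain ⟨x⟩ := h
    exact ⟨(⟨c⟩ : WideSubcategory W)⟩

lemma WideSubcategory.nonIds_top_iff {c d : WideSubcategory W} (g : c ⟶ d) :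
    nonIds ⊤ g ↔ nonIds W g.hom :=
  ⟨fun h => ⟨g.property, fun h' => h.2 ((identities_iff W g).2 h')⟩,
    fun h => ⟨trivial, fun h' => h.2 ((identities_iff W g).1 h')⟩⟩

variable {X Y : C ⥤ M} (p : X ⟶ Y) (c : WideSubcategory W)

theorem matchingLift_whiskerLeft_iff {U V : M} (i : U ⟶ V) :
    MatchingLift ⊤ (Functor.whiskerLeft (wideSubcategoryInclusion W) p) c i ↔
      MatchingLift W p c.obj i := by
  constructor
  · intro H u y x h1 h2 h3 h4
    obtain ⟨l, hl, hl', hl''⟩ := H u y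
      (fun d g hg => x g.hom ((WideSubcategory.nonIds_top_iff W g).1 hg)) h1
      (fun d g hg => h2 _ _) (fun d g hg => h3 _ _)
      (fun d e g hg h _ hgh => h4 _ _ _ h.property ((WideSubcategory.nonIds_top_iff W _).1 hgh))
    exact ⟨l, hl, hl', fun d g hg => hl'' (d := ⟨d⟩) ⟨g, hg.1⟩
      ((WideSubcategory.nonIds_top_iff W _).2 hg)⟩
  · intro H u y x h1 h2 h3 h4
    obtain ⟨l, hl, hl', hl''⟩ := H u y
      (fun d g hg => x (d := ⟨d⟩) ⟨g, hg.1⟩ ((WideSubcategory.nonIds_top_iff W _).2 hg)) h1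
      (fun d g hg => h2 _ _) (fun d g hg => h3 _ _)
      (fun d e g hg h hh hgh => h4 (d := ⟨d⟩) (e := ⟨e⟩) ⟨g, hg.1⟩ _ ⟨h, hh⟩ trivial _)
    exact ⟨l, hl, hl', fun d g hg => hl'' g.hom ((WideSubcategory.nonIds_top_iff W _).1 hg)⟩

theorem latchingLift_whiskerLeft_iff {E F : M} (i : E ⟶ F) :
    LatchingLift ⊤ (Functor.whiskerLeft (wideSubcategoryInclusion W) p) c i ↔
      LatchingLift W p c.obj i := by
  constructor
  · intro H u y x h1 h2 h3 h4
    obtain ⟨l, hl, hl', hl''⟩ := H u y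
      (fun d g hg => x g.hom ((WideSubcategory.nonIds_top_iff W g).1 hg)) h1
      (fun d g hg => h2 _ _) (fun d g hg => h3 _ _)
      (fun d e g hg h _ hgh => h4 _ _ _ h.property ((WideSubcategory.nonIds_top_iff W _).1 hgh))
    exact ⟨l, hl, hl', fun d g hg => hl'' (d := ⟨d⟩) ⟨g, hg.1⟩
      ((WideSubcategory.nonIds_top_iff W _).2 hg)⟩
  · intro H u y x h1 h2 h3 h4
    obtain ⟨l, hl, hl', hl''⟩ := H u y
      (fun d g hg => x (d := ⟨d⟩) ⟨g, hg.1⟩ ((WideSubcategory.nonIds_top_iff W _).2 hg)) h1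
      (fun d g hg => h2 _ _) (fun d g hg => h3 _ _)
      (fun d e g hg h hh hgh => h4 (d := ⟨d⟩) (d' := ⟨e⟩) ⟨g, hg.1⟩ _ ⟨h, hh⟩ trivial _)
    exact ⟨l, hl, hl', fun d g hg => hl'' g.hom ((WideSubcategory.nonIds_top_iff W _).1 hg)⟩

theorem hasLiftingProperty_relativeMatchingMap_iff [HasLimits M] {U V : M} (i : U ⟶ V) :
    HasLiftingProperty i
      (relativeMatchingMap (Functor.whiskerLeft (wideSubcategoryInclusion W) p) c) ↔
        MatchingLift W p c.obj i :=
  (hasLiftingProperty_relativeMatchingMap_iff_top _ _).trans (matchingLift_whiskerLeft_iff W p c i)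

theorem hasLiftingProperty_relativeLatchingMap_iff [HasColimits M] {E F : M} (i : E ⟶ F) :
    HasLiftingProperty
      (relativeLatchingMap (Functor.whiskerLeft (wideSubcategoryInclusion W) p) c) i ↔
        LatchingLift W p c.obj i :=
  (hasLiftingProperty_relativeLatchingMap_iff_top _ _).trans (latchingLift_whiskerLeft_iff W p c i)

end

end

/-! ### Duality between matching and latching -/

section

variable {C : Type*} [Category* C] {M : Type*} [Category* M] (W : MorphismProperty C)

lemma nonIds_op_iff {c d : C} (g : c ⟶ d) : nonIds W.op g.op ↔ nonIds W g := by
  simp only [nonIds, MorphismProperty.identities_op_iff]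
  rfl

lemma nonIds_unop_iff {c d : Cᵒᵖ} (g : c ⟶ d) : nonIds W g.unop ↔ nonIds W.op g :=
  (nonIds_op_iff W g.unop).symm

/-- Reversing all arrows in both the index category and M exchanges the two conditions; through this
and its companion, latching statements are deduced from matching statements and conversely. -/
theorem matchingLift_op_iff {X Y : C ⥤ M} (q : X ⟶ Y) (c : C) {E F : M} (p : E ⟶ F) :
    MatchingLift W.op (NatTrans.op q) (Opposite.op c) p.op ↔ LatchingLift W q c p := by
  constructor
  · intro H e y x h1 h2 h3 h4
    obtain ⟨l, hl, hl', hl''⟩ := H y.op e.op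
      (fun d g hg => (x g.unop ((nonIds_unop_iff W g).2 hg)).op)
      (Quiver.Hom.unop_inj h1)
      (fun d g hg => Quiver.Hom.unop_inj (h2 _ _))
      (fun d g hg => Quiver.Hom.unop_inj (h3 _ _))
      (fun d d' g hg h hh hgh => Quiver.Hom.unop_inj (h4 _ _ _ hh _))
    exact ⟨l.unop, congrArg Quiver.Hom.unop hl, congrArg Quiver.Hom.unop hl',
      fun d g hg => congrArg Quiver.Hom.unop (hl'' g.op ((nonIds_op_iff W g).2 hg))⟩
  · intro H y e x h1 h2 h3 h4
    obtain ⟨l, hl, hl', hl''⟩ := H e.unop y.unop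
      (fun d g hg => (x g.op ((nonIds_op_iff W g).2 hg)).unop)
      (congrArg Quiver.Hom.unop h1)
      (fun d g hg => congrArg Quiver.Hom.unop (h2 _ _))
      (fun d g hg => congrArg Quiver.Hom.unop (h3 _ _))
      (fun d d' g hg h hh hgh => congrArg Quiver.Hom.unop
        (h4 g.op ((nonIds_op_iff W g).2 hg) h.op hh ((nonIds_op_iff W (h ≫ g)).2 hgh)))
    exact ⟨l.op, Quiver.Hom.unop_inj hl, Quiver.Hom.unop_inj hl',
      fun d g hg => Quiver.Hom.unop_inj (hl'' g.unop ((nonIds_unop_iff W g).2 hg))⟩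

theorem latchingLift_op_iff {X Y : C ⥤ M} (p : X ⟶ Y) (c : C) {U V : M} (i : U ⟶ V) :
    LatchingLift W.op (NatTrans.op p) (Opposite.op c) i.op ↔ MatchingLift W p c i := by
  constructor
  · intro H u y x h1 h2 h3 h4
    obtain ⟨l, hl, hl', hl''⟩ := H y.op u.op
      (fun d g hg => (x g.unop ((nonIds_unop_iff W g).2 hg)).op)
      (Quiver.Hom.unop_inj h1)
      (fun d g hg => Quiver.Hom.unop_inj (h2 _ _))
      (fun d g hg => Quiver.Hom.unop_inj (h3 _ _))
      (fun d d' g hg h hh hgh => Quiver.Hom.unop_inj (h4 _ _ _ hh _))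
    exact ⟨l.unop, congrArg Quiver.Hom.unop hl, congrArg Quiver.Hom.unop hl',
      fun d g hg => congrArg Quiver.Hom.unop (hl'' g.op ((nonIds_op_iff W g).2 hg))⟩
  · intro H e y x h1 h2 h3 h4
    obtain ⟨l, hl, hl', hl''⟩ := H y.unop e.unop
      (fun d g hg => (x g.op ((nonIds_op_iff W g).2 hg)).unop)
      (congrArg Quiver.Hom.unop h1)
      (fun d g hg => congrArg Quiver.Hom.unop (h2 _ _))
      (fun d g hg => congrArg Quiver.Hom.unop (h3 _ _))
      (fun d d' g hg h hh hgh => congrArg Quiver.Hom.unop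
        (h4 g.op ((nonIds_op_iff W g).2 hg) h.op hh ((nonIds_op_iff W (g ≫ h)).2 hgh)))
    exact ⟨l.op, Quiver.Hom.unop_inj hl, Quiver.Hom.unop_inj hl',
      fun d g hg => Quiver.Hom.unop_inj (hl'' g.unop ((nonIds_unop_iff W g).2 hg))⟩

end

/-! ### The Reedy lifting lemma -/

/-- The universal property of the relative latching morphism `k : K ⟶ Y c` of `q : X ⟶ Y`. -/
structure IsRelativeLatching {A : Type*} [Category* A] {M : Type*} [Category* M]
    (W : MorphismProperty A) {X Y : A ⥤ M} (q : X ⟶ Y) (c : A) {K : M} (k : K ⟶ Y.obj c) where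
  /-- The first inclusion. -/
  inl : X.obj c ⟶ K
  /-- The inclusions of the components of the latching object. -/
  incl : ∀ ⦃d : A⦄ (g : d ⟶ c), nonIds W g → (Y.obj d ⟶ K)
  inl_comp : inl ≫ k = q.app c
  incl_comp : ∀ ⦃d : A⦄ (g : d ⟶ c) (hg : nonIds W g), incl g hg ≫ k = Y.map g
  hom_ext : ∀ ⦃E : M⦄ (s t : K ⟶ E), inl ≫ s = inl ≫ t →
    (∀ ⦃d : A⦄ (g : d ⟶ c) (hg : nonIds W g), incl g hg ≫ s = incl g hg ≫ t) → s = t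
  desc : ∀ ⦃E : M⦄ (e : X.obj c ⟶ E) (x : ∀ ⦃d : A⦄ (g : d ⟶ c), nonIds W g → (Y.obj d ⟶ E)),
    (∀ ⦃d : A⦄ (g : d ⟶ c) (hg : nonIds W g), q.app d ≫ x g hg = X.map g ≫ e) →
    (∀ ⦃d d' : A⦄ (g : d ⟶ c) (hg : nonIds W g) (h : d' ⟶ d) (_ : W h) (hgh : nonIds W (h ≫ g)),
      Y.map h ≫ x g hg = x (h ≫ g) hgh) →
    ∃ t : K ⟶ E, inl ≫ t = e ∧ ∀ ⦃d : A⦄ (g : d ⟶ c) (hg : nonIds W g), incl g hg ≫ t = x g hg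

namespace IsRelativeLatching

variable {A : Type*} [Category* A] {M : Type*} [Category* M] {W : MorphismProperty A}
  {X Y : A ⥤ M} {q : X ⟶ Y} {c : A} {K : M} {k : K ⟶ Y.obj c} (I : IsRelativeLatching W q c k)

lemma inl_comp_assoc {Z : M} (l : Y.obj c ⟶ Z) : I.inl ≫ k ≫ l = q.app c ≫ l := by
  rw [← Category.assoc, I.inl_comp]

lemma incl_comp_assoc ⦃d : A⦄ (g : d ⟶ c) (hg : nonIds W g) {Z : M} (l : Y.obj c ⟶ Z) :
    I.incl g hg ≫ k ≫ l = Y.map g ≫ l := by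
  rw [← Category.assoc, I.incl_comp]

end IsRelativeLatching

section

variable {C : Type w} [SmallCategory C] {M : Type u} [Category.{w} M] [HasColimits M]
  {X Y : C ⥤ M} (q : X ⟶ Y)

/-- The relative latching morphism has the universal property. -/
noncomputable def isRelativeLatchingTop (c : C) :
    IsRelativeLatching ⊤ q c (relativeLatchingMap q c) where
  inl := pushout.inl _ _
  incl d g hg := latchingIncl Y g hg ≫ pushout.inr _ _
  inl_comp := inl_relativeLatchingMap q
  incl_comp d g hg := by
    rw [Category.assoc, inr_relativeLatchingMap, latchingIncl_latchingToObj]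
  hom_ext E s t h1 h2 := by
    apply pushout.hom_ext h1
    apply latchingObj_hom_ext
    intro d g hg
    simpa using h2 g hg
  desc E e x h1 h2 := by
    obtain ⟨t, ht⟩ := exists_latchingObj_desc x (fun _ _ g hg h => h2 g hg h trivial)
    refine ⟨pushout.desc e t ?_, pushout.inl_desc _ _ _, fun d g hg => ?_⟩
    · apply latchingObj_hom_ext
      intro d g hg
      rw [latchingIncl_latchingMap_assoc, latchingIncl_latchingToObj_assoc, ht, h1]
    · rw [Category.assoc, pushout.inr_desc, ht]

/-- The relative latching morphism of the restriction to a wide subcategory has the universal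
property. -/
noncomputable def isRelativeLatching (W : MorphismProperty C) [W.IsMultiplicative] (c : C) :
    IsRelativeLatching W q c
      (relativeLatchingMap (Functor.whiskerLeft (wideSubcategoryInclusion W) q) ⟨c⟩) :=
  let I := isRelativeLatchingTop (Functor.whiskerLeft (wideSubcategoryInclusion W) q) ⟨c⟩
  have nid ⦃d : C⦄ (g : d ⟶ c) (hg : nonIds W g) :
      nonIds ⊤ (⟨g, hg.1⟩ : (⟨d⟩ : WideSubcategory W) ⟶ ⟨c⟩) :=
    (WideSubcategory.nonIds_top_iff W _).2 hg
  { inl := I.inl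
    incl := fun d g hg => I.incl (d := ⟨d⟩) ⟨g, hg.1⟩ (nid g hg)
    inl_comp := I.inl_comp
    incl_comp := fun d g hg => I.incl_comp (d := ⟨d⟩) ⟨g, hg.1⟩ (nid g hg)
    hom_ext := fun E s t h1 h2 => I.hom_ext s t h1
      (fun d g hg => h2 g.hom ((WideSubcategory.nonIds_top_iff W _).1 hg))
    desc := fun E e x h1 h2 => by
      obtain ⟨t, ht, ht'⟩ := I.desc e
        (fun d g hg => x g.hom ((WideSubcategory.nonIds_top_iff W _).1 hg))
        (fun d g hg => h1 _ _)
        (fun d d' g hg h _ hgh => h2 _ _ _ h.property ((WideSubcategory.nonIds_top_iff W _).1 hgh))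
      exact ⟨t, ht, fun d g hg => ht' (d := ⟨d⟩) ⟨g, hg.1⟩ (nid g hg)⟩ }

end

section

variable {A : Type w} [SmallCategory A] {W₁ W₂ : MorphismProperty A} [W₁.IsMultiplicative]
  [W₂.IsMultiplicative] (r : ReedyStructure W₁ W₂ Ordinal.{w}) {M : Type u} [Category.{w} M]

include r in
-- The lift is built by recursion on the degree. At c, the components in lower degree induce a map
-- out of the source of the relative latching map and a compatible family into the matching diagram
-- of P; a solution of the resulting lifting problem is the component at c.
theorem hasLiftingProperty_of_matchingLift {X Y P Q : A ⥤ M} (q : X ⟶ Y)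
    (p : P ⟶ Q)
    (H : ∀ c : A, ∃ (K : M) (k : K ⟶ Y.obj c) (_ : IsRelativeLatching W₂ q c k),
      MatchingLift W₁ p c k) :
    HasLiftingProperty q p := by
  refine ⟨fun {u t} sq => ?_⟩
  let Good : ∀ c : A, (∀ d, r.deg d < r.deg c → (Y.obj d ⟶ P.obj d)) → (Y.obj c ⟶ P.obj c) → Prop :=
    fun c l k => q.app c ≫ k = u.app c ∧ k ≫ p.app c = t.app c ∧
      (∀ ⦃d : A⦄ (g : c ⟶ d) (hg : nonIds W₁ g), k ≫ P.map g = Y.map g ≫ l d (r.lt₁ g hg.1 hg.2)) ∧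
      (∀ ⦃d : A⦄ (g : d ⟶ c) (hg : nonIds W₂ g), Y.map g ≫ k = l d (r.lt₂ g hg.1 hg.2) ≫ P.map g)
  obtain ⟨l, hl⟩ := exists_forall_of_rank r.deg Good (by
    intro c l hl
    have nat₁ ⦃d e : A⦄ (g : d ⟶ e) (hg : W₁ g) (hd : r.deg d < r.deg c) :
        l d hd ≫ P.map g = Y.map g ≫ l e ((r.le₁ g hg).trans_lt hd) := by
      by_cases hg' : MorphismProperty.identities A g
      · obtain ⟨⟩ := hg'
        simp
      · exact (hl d hd).2.2.1 g ⟨hg, hg'⟩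
    have nat₂ ⦃d e : A⦄ (g : d ⟶ e) (hg : W₂ g) (he : r.deg e < r.deg c) :
        l d ((r.le₂ g hg).trans_lt he) ≫ P.map g = Y.map g ≫ l e he := by
      by_cases hg' : MorphismProperty.identities A g
      · obtain ⟨⟩ := hg'
        simp
      · exact ((hl e he).2.2.2 g ⟨hg, hg'⟩).symm
    -- A direct morphism into `c` followed by an inverse one out of `c` is in neither class. Its
    -- Reedy factorization passes through an object of degree below that of `c`, so the two halves
    -- are already natural.
    have nat ⦃d e : A⦄ (g : d ⟶ e) (hd : r.deg d < r.deg c) (he : r.deg e < r.deg c) :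
        l d hd ≫ P.map g = Y.map g ≫ l e he := by
      obtain ⟨z, a, b, ha, hb, rfl, -⟩ := r.exists_fac g
      rw [P.map_comp, reassoc_of% (nat₁ a ha hd), nat₂ b hb he, Y.map_comp, Category.assoc]
    obtain ⟨K, κ, I, hM⟩ := H c
    obtain ⟨s, hs, hs'⟩ := I.desc (u.app c) (fun d g hg => l d (r.lt₂ g hg.1 hg.2) ≫ P.map g)
      (fun d g hg => by
        rw [u.naturality, ← (hl d (r.lt₂ g hg.1 hg.2)).1, Category.assoc])
      (fun d d' g hg h hh hgh => by
        rw [← reassoc_of% (nat₂ h hh (r.lt₂ g hg.1 hg.2)), P.map_comp])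
    obtain ⟨k, h1, h2, h3⟩ := hM s (t.app c) (fun d g hg => Y.map g ≫ l d (r.lt₁ g hg.1 hg.2))
      (by
        apply I.hom_ext
        · rw [I.inl_comp_assoc, reassoc_of% hs]
          exact (NatTrans.congr_app sq.w c).symm
        · intro d g hg
          rw [I.incl_comp_assoc, reassoc_of% (hs' g hg), p.naturality,
            reassoc_of% (hl d (r.lt₂ g hg.1 hg.2)).2.1, t.naturality])
      (fun d g hg => by
        apply I.hom_ext
        · rw [I.inl_comp_assoc, reassoc_of% hs, ← u.naturality,
            ← (hl d (r.lt₁ g hg.1 hg.2)).1, q.naturality_assoc]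
        · intro d' g' hg'
          rw [I.incl_comp_assoc, reassoc_of% (hs' g' hg'), ← P.map_comp,
            nat _ _ (r.lt₁ g hg.1 hg.2), Y.map_comp, Category.assoc])
      (fun d g hg => by
        rw [Category.assoc, (hl d (r.lt₁ g hg.1 hg.2)).2.1, t.naturality])
      (fun d e g hg h hh hgh => by
        rw [Category.assoc, nat₁ h hh, Y.map_comp, Category.assoc])
    refine ⟨k, ?_, h2, h3, fun d g hg => ?_⟩
    · rw [← I.inl_comp_assoc, h1, hs]
    · rw [← I.incl_comp_assoc g hg, h1, hs'])
  have nat₁ ⦃d e : A⦄ (g : d ⟶ e) (hg : W₁ g) : l d ≫ P.map g = Y.map g ≫ l e := by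
    by_cases hg' : MorphismProperty.identities A g
    · obtain ⟨⟩ := hg'
      simp
    · exact (hl d).2.2.1 g ⟨hg, hg'⟩
  have nat₂ ⦃d e : A⦄ (g : d ⟶ e) (hg : W₂ g) : l d ≫ P.map g = Y.map g ≫ l e := by
    by_cases hg' : MorphismProperty.identities A g
    · obtain ⟨⟩ := hg'
      simp
    · exact ((hl e).2.2.2 g ⟨hg, hg'⟩).symm
  exact ⟨⟨{
    l :=
      { app := l
        naturality := fun d e g => by
          obtain ⟨z, a, b, ha, hb, rfl, -⟩ := r.exists_fac g
          rw [P.map_comp, reassoc_of% (nat₁ a ha), nat₂ b hb, Y.map_comp, Category.assoc] }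
    fac_left := by ext c; exact (hl c).1
    fac_right := by ext c; exact (hl c).2.1 }⟩⟩

end

/-! ### Right Kan extension from a slice category -/

section

variable {A : Type w} [SmallCategory A] {M : Type u} [Category.{w} M] [HasLimits M] {α : A}

/-- The right Kan extension of a functor on a slice category along the forgetful functor. -/
noncomputable def prodFunctor (Q : Over α ⥤ M) : A ⥤ M where
  obj β := ∏ᶜ fun h : β ⟶ α => Q.obj (Over.mk h)
  map {β _} k := Pi.lift fun h' =>
    Pi.π (fun h : β ⟶ α => Q.obj (Over.mk h)) (k ≫ h') ≫ Q.map (Over.homMk k)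
  map_id β := by
    apply Pi.hom_ext
    intro h'
    -- The index `𝟙 β ≫ h'` equals `h'` only propositionally, so the identity is proved for a
    -- variable index and then specialized.
    have (h : β ⟶ α) (e : Over.mk h ⟶ Over.mk h') (he : e.left = 𝟙 β) :
        Pi.π (fun h : β ⟶ α => Q.obj (Over.mk h)) h ≫ Q.map e =
          Pi.π (fun h : β ⟶ α => Q.obj (Over.mk h)) h' := by
      obtain rfl : h = h' := by simpa [he] using (Over.w e).symm
      obtain rfl : e = 𝟙 _ := by ext; exact he
      simp
    rw [Pi.lift_π]
    exact (this _ _ rfl).trans (Category.id_comp _).symm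
  map_comp {β γ δ} k k' := by
    apply Pi.hom_ext
    intro h'
    have (h₁ h₂ : β ⟶ α) (e₁ : Over.mk h₁ ⟶ Over.mk h') (e₂ : Over.mk h₂ ⟶ Over.mk h')
        (h : h₁ = h₂) (he : e₁.left = e₂.left) :
        Pi.π (fun h : β ⟶ α => Q.obj (Over.mk h)) h₁ ≫ Q.map e₁ =
          Pi.π (fun h : β ⟶ α => Q.obj (Over.mk h)) h₂ ≫ Q.map e₂ := by
      subst h
      obtain rfl : e₁ = e₂ := by ext; exact he
      rfl
    simp only [Pi.lift_π, Category.assoc, Pi.lift_π_assoc, ← Q.map_comp]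
    exact this _ _ _ _ (Category.assoc _ _ _) rfl

/-- The projections from the values of `prodFunctor`. -/
noncomputable def prodProj (Q : Over α ⥤ M) {β : A} (h : β ⟶ α) :
    (prodFunctor Q).obj β ⟶ Q.obj (Over.mk h) :=
  Pi.π _ h

lemma prodFunctor_hom_ext {Q : Over α ⥤ M} {β : A} {V : M} {s t : V ⟶ (prodFunctor Q).obj β}
    (H : ∀ h : β ⟶ α, s ≫ prodProj Q h = t ≫ prodProj Q h) : s = t :=
  Pi.hom_ext _ _ H

/-- A morphism to a value of `prodFunctor`. -/
noncomputable def prodLift (Q : Over α ⥤ M) {β : A} {V : M}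
    (l : ∀ h : β ⟶ α, V ⟶ Q.obj (Over.mk h)) : V ⟶ (prodFunctor Q).obj β :=
  Pi.lift l

lemma prodLift_prodProj (Q : Over α ⥤ M) {β : A} {V : M}
    (l : ∀ h : β ⟶ α, V ⟶ Q.obj (Over.mk h)) (h : β ⟶ α) :
    prodLift Q l ≫ prodProj Q h = l h :=
  Pi.lift_π _ _

lemma prodLift_prodProj_assoc (Q : Over α ⥤ M) {β : A} {V Z : M}
    (l : ∀ h : β ⟶ α, V ⟶ Q.obj (Over.mk h)) (h : β ⟶ α) (k : Q.obj (Over.mk h) ⟶ Z) :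
    prodLift Q l ≫ prodProj Q h ≫ k = l h ≫ k := by
  rw [← Category.assoc, prodLift_prodProj]

/-- The morphism in a slice category given by a factorization. -/
abbrev overHom {β γ : A} (k : β ⟶ γ) (h' : γ ⟶ α) (h : β ⟶ α) (e : k ≫ h' = h) :
    Over.mk h ⟶ Over.mk h' :=
  Over.homMk (U := Over.mk h) (V := Over.mk h') k e

lemma prodFunctor_map_prodProj (Q : Over α ⥤ M) {β γ : A} (k : β ⟶ γ) (h' : γ ⟶ α) (h : β ⟶ α)
    (e : k ≫ h' = h) :
    (prodFunctor Q).map k ≫ prodProj Q h' = prodProj Q h ≫ Q.map (overHom k h' h e) := by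
  subst e
  exact Pi.lift_π _ _

lemma prodFunctor_map_prodProj_assoc (Q : Over α ⥤ M) {β γ : A} (k : β ⟶ γ) (h' : γ ⟶ α)
    (h : β ⟶ α) (e : k ≫ h' = h) {Z : M} (l : Q.obj (Over.mk h') ⟶ Z) :
    (prodFunctor Q).map k ≫ prodProj Q h' ≫ l =
      prodProj Q h ≫ Q.map (overHom k h' h e) ≫ l := by
  rw [← Category.assoc, prodFunctor_map_prodProj Q k h' h e, Category.assoc]

/-- The functoriality of `prodFunctor`. -/
noncomputable def prodMap {P Q : Over α ⥤ M} (τ : P ⟶ Q) : prodFunctor P ⟶ prodFunctor Q where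
  app β := prodLift Q fun h => prodProj P h ≫ τ.app (Over.mk h)
  naturality β γ k := by
    apply prodFunctor_hom_ext
    intro h
    rw [Category.assoc, prodLift_prodProj, prodFunctor_map_prodProj_assoc P k h _ rfl,
      Category.assoc, prodFunctor_map_prodProj Q k h _ rfl, prodLift_prodProj_assoc,
      τ.naturality, Category.assoc]

lemma prodMap_app_prodProj {P Q : Over α ⥤ M} (τ : P ⟶ Q) {β : A} (h : β ⟶ α) :
    (prodMap τ).app β ≫ prodProj Q h = prodProj P h ≫ τ.app (Over.mk h) :=
  prodLift_prodProj _ _ _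

end

lemma mem_of_identities {C : Type*} [Category* C] (W : MorphismProperty C) [W.ContainsIdentities]
    {X Y : C} {g : X ⟶ Y} (hg : MorphismProperty.identities C g) : W g := by
  obtain ⟨⟩ := hg
  exact W.id_mem _

section

variable {A : Type w} [SmallCategory A] {W₁ W₂ : MorphismProperty A} [W₁.IsMultiplicative]
  [W₂.IsMultiplicative] (r : ReedyStructure W₁ W₂ Ordinal.{w})

include r in
-- Uniqueness of Reedy factorizations as a transport principle: the motive quantifies over the
-- middle object, which keeps `eqToHom` out of later arguments.
lemma HomotopicalAlgebra.ReedyStructure.factorization_ext {X Y : A}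
    {motive : ∀ {Z : A}, (X ⟶ Z) → (Z ⟶ Y) → Prop}
    {Z Z' : A} (a : X ⟶ Z) (b : Z ⟶ Y) (a' : X ⟶ Z') (b' : Z' ⟶ Y) (ha : W₁ a) (hb : W₂ b)
    (ha' : W₁ a') (hb' : W₂ b') (h : a ≫ b = a' ≫ b') (H : motive a b) : motive a' b' := by
  obtain ⟨e, h1, h2⟩ := r.unique (f := a ≫ b) (.mk Z a b rfl ha hb) (.mk Z' a' b' h.symm ha' hb')
  dsimp at e h1 h2
  subst e
  simp only [eqToHom_refl, Category.comp_id, Category.id_comp] at h1 h2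
  subst h1 h2
  exact H

include r in
lemma HomotopicalAlgebra.ReedyStructure.nonIds_comp₁ {X Y Z : A} (g : X ⟶ Y) (hg : nonIds W₁ g)
    (h : Y ⟶ Z) (hh : W₁ h) : nonIds W₁ (g ≫ h) :=
  ⟨W₁.comp_mem _ _ hg.1 hh, fun H => by
    have h1 := r.lt₁ g hg.1 hg.2
    have h2 := r.le₁ h hh
    have h3 := r.le₂ (g ≫ h) (mem_of_identities W₂ H)
    exact absurd (h3.trans h2) (not_le.2 h1)⟩

include r in
lemma HomotopicalAlgebra.ReedyStructure.nonIds_comp₂ {X Y Z : A} (g : X ⟶ Y) (hg : W₂ g)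
    (h : Y ⟶ Z) (hh : nonIds W₂ h) : nonIds W₂ (g ≫ h) :=
  ⟨W₂.comp_mem _ _ hg hh.1, fun H => by
    have h1 := r.lt₂ h hh.1 hh.2
    have h2 := r.le₂ g hg
    have h3 := r.le₁ (g ≫ h) (mem_of_identities W₁ H)
    exact absurd (h2.trans_lt h1) (not_lt.2 h3)⟩

include r in
-- The middle object of the factorization of g ≫ h has degree at most that for h, which is at most
-- deg Z. If g ≫ h is inverse these are all equal, so h has no nontrivial direct part. Hence the
-- inverse morphisms form a cosieve in the slice over a fixed object.
lemma HomotopicalAlgebra.ReedyStructure.of_comp₁ {X Y Z : A} (g : X ⟶ Y)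
    (h : Y ⟶ Z) (H : W₁ (g ≫ h)) : W₁ h := by
  refine r.prop₁_of_degHom_eq_deg_right (le_antisymm (r.degHom_le_deg_right h) ?_)
  refine le_trans ?_ (r.degHom_comp_le_right g h)
  exact (r.degHom_eq (.mk Z (g ≫ h) (𝟙 Z) (by simp) H (W₂.id_mem _))).ge

variable {M : Type u} [Category.{w} M] [HasLimits M] {α : A}

include r in
-- A component h : β ⟶ α with a nonidentity inverse factor is determined by the matching data; only
-- direct h leave an actual lifting problem, which is one against the component of τ at h.
theorem matchingLift_prodMap {E : M} {Q : Over α ⥤ M} (τ : (Functor.const (Over α)).obj E ⟶ Q)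
    {U V : M} (i : U ⟶ V)
    (hQ : ∀ ⦃β γ : A⦄ (g : β ⟶ γ) (h : γ ⟶ α), W₁ g →
      Mono (Q.map (overHom g h (g ≫ h) rfl)))
    (hi : ∀ ⦃β : A⦄ (h : β ⟶ α), W₂ h → HasLiftingProperty i (τ.app (Over.mk h))) (β : A) :
    MatchingLift W₁ (prodMap τ) β i := by
  intro u y x h1 h2 h3 h4
  let K := (Functor.const (Over α)).obj E
  have (h : β ⟶ α) : ∃ l : V ⟶ E, i ≫ l = u ≫ prodProj K h ∧
      l ≫ τ.app (Over.mk h) = y ≫ prodProj Q h ∧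
      ∀ ⦃γ : A⦄ (g : β ⟶ γ) (hg : nonIds W₁ g) (h' : γ ⟶ α), g ≫ h' = h →
        l = x g hg ≫ prodProj K h' := by
    obtain ⟨Z, g, m, hg, hm, rfl, hZ⟩ := r.exists_fac h
    by_cases hg' : MorphismProperty.identities A g
    · obtain ⟨⟩ := hg'
      have := hi (𝟙 β ≫ m) (W₂.comp_mem _ _ (W₂.id_mem _) hm)
      have sq : CommSq (u ≫ prodProj K (𝟙 β ≫ m)) i (τ.app (Over.mk (𝟙 β ≫ m)))
          (y ≫ prodProj Q (𝟙 β ≫ m)) := ⟨by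
        rw [Category.assoc, ← prodMap_app_prodProj, reassoc_of% h1]⟩
      refine ⟨sq.lift, sq.fac_left, sq.fac_right, fun γ g hg h' e => ?_⟩
      -- Here the middle object of the factorization of `h` is `β` itself, so `h` cannot factor
      -- through an object of lower degree and the last condition is vacuous.
      have h5 := r.lt₁ g hg.1 hg.2
      have h6 := r.degHom_le g h'
      rw [e, hZ] at h6
      exact absurd h5 (not_lt.2 h6)
    · refine ⟨x g ⟨hg, hg'⟩ ≫ prodProj K m, ?_, ?_, fun γ g₁ hg₁ h₁ e => ?_⟩
      · rw [reassoc_of% (h2 g ⟨hg, hg'⟩), prodFunctor_map_prodProj K g m _ rfl]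
        exact congrArg _ (Category.comp_id _)
      · have := hQ g m hg
        rw [← cancel_mono (Q.map (overHom g m (g ≫ m) rfl))]
        simp only [Category.assoc]
        rw [← prodFunctor_map_prodProj Q g m _ rfl, ← τ.naturality,
          ← reassoc_of% (h3 g ⟨hg, hg'⟩), prodMap_app_prodProj]
        congr 2
        exact Category.id_comp _
      -- Factoring `h₁` turns any factorization of `h` through a nonidentity inverse morphism into
      -- its Reedy factorization, so the value does not depend on the choice.
      · obtain ⟨Z', g₂, m₂, hg₂, hm₂, rfl, -⟩ := r.exists_fac h₁
        have hg₁₂ := r.nonIds_comp₁ g₁ hg₁ g₂ hg₂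
        have h5 : x g₁ hg₁ ≫ prodProj K (g₂ ≫ m₂) = x (g₁ ≫ g₂) hg₁₂ ≫ prodProj K m₂ := by
          rw [← h4 g₁ hg₁ g₂ hg₂ hg₁₂, Category.assoc, prodFunctor_map_prodProj K g₂ m₂ _ rfl]
          exact (congrArg _ (Category.comp_id _)).symm
        rw [h5]
        exact r.factorization_ext (motive := fun a b => ∀ ha, x g ⟨hg, hg'⟩ ≫ prodProj K m =
          x a ha ≫ prodProj K b) g m _ m₂ hg hm hg₁₂.1 hm₂ (by simpa using e.symm)
          (fun _ => rfl) hg₁₂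
  choose l hl1 hl2 hl3 using this
  refine ⟨prodLift K l, ?_, ?_, fun γ g hg => ?_⟩
  · apply prodFunctor_hom_ext
    intro h
    rw [Category.assoc, prodLift_prodProj, hl1]
  · apply prodFunctor_hom_ext
    intro h
    rw [Category.assoc, prodMap_app_prodProj, prodLift_prodProj_assoc, hl2]
  · apply prodFunctor_hom_ext
    intro h
    rw [Category.assoc, prodFunctor_map_prodProj K g h _ rfl, prodLift_prodProj_assoc,
      ← hl3 (g ≫ h) g hg h rfl]
    exact Category.comp_id _

end

/-- The functor equal to `E` off a cosieve `S` and to `F` on it. -/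
theorem exists_cosieve_functor {D : Type*} [Category* D] {M : Type*} [Category* M] {E F : M}
    (p : E ⟶ F) (S : D → Prop) (hS : ∀ ⦃z z' : D⦄ (_ : z ⟶ z'), S z → S z') :
    ∃ (Q : D ⥤ M) (τ : (Functor.const D).obj E ⟶ Q) (κ : Q ⟶ (Functor.const D).obj F),
      (∀ z, τ.app z ≫ κ.app z = p) ∧ (∀ z, S z → IsIso (κ.app z)) ∧
        (∀ z, ¬ S z → IsIso (τ.app z)) := by
  classical
  -- A cosieve is classified by a functor to the poset 0 < 1; `Q` is this functor followed by `p`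
  -- viewed as a functor on that poset.
  let χ : D ⥤ Fin 2 :=
    { obj := fun z => if S z then 1 else 0
      map := fun {z z'} k => homOfLE (by
        by_cases h : S z
        · simp [h, hS k h]
        · simp [h]) }
  let N := ComposableArrows.mk₁ p
  refine ⟨χ ⋙ N,
    { app := fun z => N.map (homOfLE (Fin.zero_le _) : (0 : Fin 2) ⟶ χ.obj z)
      naturality := fun z z' k => ?_ },
    { app := fun z => N.map (homOfLE (Fin.le_last _) : χ.obj z ⟶ (1 : Fin 2))
      naturality := fun z z' k => ?_ }, fun z => ?_, fun z hz => ?_, fun z hz => ?_⟩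
  · exact (Category.id_comp _).trans ((congrArg N.map (Subsingleton.elim _ _)).trans
      (N.map_comp (homOfLE (Fin.zero_le _) : (0 : Fin 2) ⟶ χ.obj z) (χ.map k)))
  · exact ((N.map_comp (χ.map k) (homOfLE (Fin.le_last _) : χ.obj z' ⟶ (1 : Fin 2))).symm.trans
      (congrArg N.map (Subsingleton.elim _ _))).trans (Category.comp_id _).symm
  · exact (N.map_comp (homOfLE (Fin.zero_le _) : (0 : Fin 2) ⟶ χ.obj z)
      (homOfLE (Fin.le_last _) : χ.obj z ⟶ (1 : Fin 2))).symm
  · have : χ.obj z = 1 := if_pos hz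
    have (j : Fin 2) (hj : j = 1) : IsIso (N.map (homOfLE (Fin.le_last _) : j ⟶ (1 : Fin 2))) := by
      subst hj
      exact inferInstanceAs (IsIso (N.map (𝟙 _)))
    exact this _ ‹_›
  · have : χ.obj z = 0 := if_neg hz
    have (j : Fin 2) (hj : j = 0) : IsIso (N.map (homOfLE (Fin.zero_le _) : (0 : Fin 2) ⟶ j)) := by
      subst hj
      exact inferInstanceAs (IsIso (N.map (𝟙 _)))
    exact this _ ‹_›

/-! ### Detecting latching lifts by lifting against test diagrams -/

section

variable {A : Type w} [SmallCategory A] {W₁ W₂ : MorphismProperty A} [W₁.IsMultiplicative]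
  [W₂.IsMultiplicative] (r : ReedyStructure W₁ W₂ Ordinal.{w})
  {M : Type u} [Category.{w} M] [HasLimits M]

include r in
-- Let Q on the slice over α be F on inverse morphisms and E elsewhere. By adjunction, maps from Y
-- to its right Kan extension encode a map Y α ⟶ F together with compatible lifts to E on the
-- latching diagram, while maps to the extension of the constant E are maps Y α ⟶ E. Thus the
-- latching problem becomes a lifting problem of q against `prodMap τ`, whose relative matching maps
-- inherit lifting from p.
theorem latchingLift_of_forall_hasLiftingProperty {X Y : A ⥤ M} (q : X ⟶ Y) (α : A) {E F : M}
    (p : E ⟶ F)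
    (H : ∀ {G K : A ⥤ M} (ψ : G ⟶ K), (∀ (β : A) {U V : M} (i : U ⟶ V), HasLiftingProperty i p →
      MatchingLift W₁ ψ β i) → HasLiftingProperty q ψ) :
    LatchingLift W₂ q α p := by
  intro e y x h1 h2 h3 h4
  obtain ⟨Q, τ, κ, hτκ, hκ, hτ⟩ := exists_cosieve_functor p (fun z : Over α => W₁ z.hom)
    (fun z z' k hz => r.of_comp₁ (Over.Hom.left k) z'.hom (by rwa [Over.w]))
  have τ_nat ⦃z z' : Over α⦄ (k : z ⟶ z') : τ.app z ≫ Q.map k = τ.app z' :=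
    (τ.naturality k).symm.trans (Category.id_comp _)
  have κ_nat ⦃z z' : Over α⦄ (k : z ⟶ z') : Q.map k ≫ κ.app z' = κ.app z :=
    (κ.naturality k).trans (Category.comp_id _)
  let K := (Functor.const (Over α)).obj E
  have lift : HasLiftingProperty q (prodMap τ) := H _ fun β U V i hi =>
    matchingLift_prodMap r τ i
      (fun β γ g h hg => by
        by_cases hh : W₁ h
        · have := hκ (Over.mk h) hh
          have := hκ (Over.mk (g ≫ h)) (W₁.comp_mem _ _ hg hh)
          have e := κ_nat (overHom g h (g ≫ h) rfl)
          have : IsIso (Q.map (overHom g h (g ≫ h) rfl) ≫ κ.app (Over.mk h)) := by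
            rw [e]
            infer_instance
          have := IsIso.of_isIso_comp_right (Q.map (overHom g h (g ≫ h) rfl)) (κ.app (Over.mk h))
          infer_instance
        · have := hτ (Over.mk h) hh
          have := hτ (Over.mk (g ≫ h)) (fun h' => hh (r.of_comp₁ _ _ h'))
          have e := τ_nat (overHom g h (g ≫ h) rfl)
          have : IsIso (τ.app (Over.mk (g ≫ h)) ≫ Q.map (overHom g h (g ≫ h) rfl)) := by
            rw [e]
            infer_instance
          have := IsIso.of_isIso_comp_left (τ.app (Over.mk (g ≫ h)))
            (Q.map (overHom g h (g ≫ h) rfl))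
          infer_instance)
      (fun β h _ => by
        by_cases hh : W₁ h
        · have := hκ (Over.mk h) hh
          have e : τ.app (Over.mk h) = p ≫ inv (κ.app (Over.mk h)) := by simp [← hτκ (Over.mk h)]
          rw [e]
          infer_instance
        · have := hτ (Over.mk h) hh
          infer_instance) β
  -- The component at `h` comes from `y` if `h` is inverse; otherwise its direct factor is not an
  -- identity and the component comes from `x`.
  have (β : A) (h : β ⟶ α) : ∃ t : Y.obj β ⟶ Q.obj (Over.mk h),
      t ≫ κ.app (Over.mk h) = Y.map h ≫ y ∧
      ∀ ⦃γ : A⦄ (g : β ⟶ γ) (m : γ ⟶ α) (hm : nonIds W₂ m), g ≫ m = h →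
        t = Y.map g ≫ x m hm ≫ τ.app (Over.mk h) := by
    by_cases hh : W₁ h
    · have := hκ (Over.mk h) hh
      refine ⟨Y.map h ≫ y ≫ inv (κ.app (Over.mk h)), by simp, fun γ g m hm e => ?_⟩
      rw [← cancel_mono (κ.app (Over.mk h))]
      simp only [Category.assoc, IsIso.inv_hom_id, Category.comp_id, hτκ, h2]
      rw [← Y.map_comp_assoc, e]
    · obtain ⟨Z, g, m, hg, hm, hgm, -⟩ := r.exists_fac h
      have hm' : nonIds W₂ m := ⟨hm, fun H => hh (by
        rw [← hgm]
        exact W₁.comp_mem _ _ hg (mem_of_identities W₁ H))⟩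
      refine ⟨Y.map g ≫ x m hm' ≫ τ.app (Over.mk h), ?_, fun γ g₁ m₁ hm₁ e => ?_⟩
      · simp only [Category.assoc, hτκ, h2]
        rw [← Y.map_comp_assoc, hgm]
      · obtain ⟨Z', g₂, m₂, hg₂, hm₂, rfl, -⟩ := r.exists_fac g₁
        have hm₁₂ := r.nonIds_comp₂ m₂ hm₂ m₁ hm₁
        rw [Y.map_comp, Category.assoc, reassoc_of% (h4 m₁ hm₁ m₂ hm₂ hm₁₂)]
        exact r.factorization_ext (motive := fun a b => ∀ hb, Y.map g ≫ x m hm' ≫ τ.app (Over.mk h)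
          = Y.map a ≫ x b hb ≫ τ.app (Over.mk h)) g m g₂ _ hg hm hg₂ hm₁₂.1
          (by rw [hgm, ← e, Category.assoc]) (fun _ => rfl) hm₁₂
  choose t ht ht' using this
  let s : X ⟶ prodFunctor K :=
    { app := fun β => prodLift K fun h => X.map h ≫ e
      naturality := fun β γ k => by
        apply prodFunctor_hom_ext
        intro h
        rw [Category.assoc, Category.assoc, prodLift_prodProj, prodFunctor_map_prodProj K k h _ rfl,
          prodLift_prodProj_assoc, X.map_comp, Category.assoc,
          Category.assoc]
        exact congrArg (X.map k ≫ ·) (congrArg (X.map h ≫ ·) (Category.comp_id e).symm) }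
  let T : Y ⟶ prodFunctor Q :=
    { app := fun β => prodLift Q (t β)
      naturality := fun β γ k => by
        apply prodFunctor_hom_ext
        intro h
        rw [Category.assoc, Category.assoc, prodLift_prodProj, prodFunctor_map_prodProj Q k h _ rfl,
          prodLift_prodProj_assoc]
        by_cases hh : W₁ h
        · have := hκ (Over.mk h) hh
          rw [← cancel_mono (κ.app (Over.mk h)), Category.assoc, Category.assoc, ht, κ_nat, ht,
            Y.map_comp, Category.assoc]
        · obtain ⟨Z, g, m, hg, hm, hgm, -⟩ := r.exists_fac h
          have hm' : nonIds W₂ m := ⟨hm, fun H => hh (by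
            rw [← hgm]
            exact W₁.comp_mem _ _ hg (mem_of_identities W₁ H))⟩
          rw [ht' γ h g m hm' hgm, ht' β (k ≫ h) (k ≫ g) m hm' (by rw [Category.assoc, hgm])]
          simp only [Category.assoc, τ_nat, Y.map_comp] }
  have sq : CommSq s q (prodMap τ) T := ⟨by
    ext β
    apply prodFunctor_hom_ext
    intro h
    simp only [NatTrans.comp_app, Category.assoc, prodMap_app_prodProj, s, T, prodLift_prodProj]
    rw [prodLift_prodProj_assoc]
    by_cases hh : W₁ h
    · have := hκ (Over.mk h) hh
      rw [← cancel_mono (κ.app (Over.mk h)), Category.assoc, Category.assoc, Category.assoc, hτκ,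
        ht, h1, q.naturality_assoc]
    · obtain ⟨Z, g, m, hg, hm, hgm, -⟩ := r.exists_fac h
      have hm' : nonIds W₂ m := ⟨hm, fun H => hh (by
        rw [← hgm]
        exact W₁.comp_mem _ _ hg (mem_of_identities W₁ H))⟩
      rw [ht' β h g m hm' hgm, ← q.naturality_assoc, reassoc_of% (h3 m hm'),
        ← X.map_comp_assoc, hgm, Category.assoc]⟩
  refine ⟨sq.lift.app α ≫ prodProj K (𝟙 α), ?_, ?_, fun β m hm => ?_⟩
  · have h5 := NatTrans.congr_app sq.fac_right α =≫ prodProj Q (𝟙 α)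
    rw [NatTrans.comp_app, Category.assoc, prodMap_app_prodProj, prodLift_prodProj] at h5
    have h6 := h5 =≫ κ.app _
    rw [ht, Category.assoc, Category.assoc, hτκ, Y.map_id, Category.id_comp] at h6
    rw [Category.assoc]
    exact h6
  · have h5 := NatTrans.congr_app sq.fac_left α =≫ prodProj K (𝟙 α)
    rw [NatTrans.comp_app, Category.assoc, prodLift_prodProj, X.map_id, Category.id_comp] at h5
    exact h5
  · have hm₁ : ¬ W₁ m := fun h => absurd (r.lt₂ m hm.1 hm.2) (not_lt.2 (r.le₁ m h))
    have := hτ (Over.mk m) hm₁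
    have h5 := NatTrans.congr_app sq.fac_right β =≫ prodProj Q m
    rw [NatTrans.comp_app, Category.assoc, prodMap_app_prodProj, prodLift_prodProj,
      ht' β m (𝟙 β) m hm (Category.id_comp _), Y.map_id, Category.id_comp, ← Category.assoc,
      cancel_mono] at h5
    rw [← h5, ← Category.assoc, sq.lift.naturality, Category.assoc,
      prodFunctor_map_prodProj K m _ m (Category.comp_id _)]
    exact congrArg _ (Category.comp_id _)

end

lemma hasLiftingProperty_natTrans_op {C : Type*} [Category* C] {D : Type*} [Category* D]
    {X Y P Q : C ⥤ D} (q : X ⟶ Y) (p : P ⟶ Q) [HasLiftingProperty q p] :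
    HasLiftingProperty (NatTrans.op p) (NatTrans.op q) := by
  refine ⟨fun {u v} sq => ?_⟩
  have sq' : CommSq (NatTrans.removeOp v) q p (NatTrans.removeOp u) := ⟨by
    ext c
    exact (congrArg Quiver.Hom.unop (NatTrans.congr_app sq.w (Opposite.op c))).symm⟩
  exact ⟨⟨{
    l := NatTrans.op sq'.lift
    fac_left := by
      ext c
      exact congrArg Quiver.Hom.op (NatTrans.congr_app sq'.fac_right c.unop)
    fac_right := by
      ext c
      exact congrArg Quiver.Hom.op (NatTrans.congr_app sq'.fac_left c.unop) }⟩⟩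

/-! ### Reedy left and Reedy right maps -/

section

variable {A : Type w} [SmallCategory A] {M : Type u} [Category.{w} M]

/-- The morphisms whose relative matching morphisms have the right lifting property
with respect to `L`. -/
def ReedyRight (W : MorphismProperty A) (L : MorphismProperty M) {X Y : A ⥤ M} (p : X ⟶ Y) : Prop :=
  ∀ (c : A) ⦃U V : M⦄ (i : U ⟶ V), L i → MatchingLift W p c i

/-- The morphisms whose relative latching morphisms have the left lifting property
with respect to `R`. -/
def ReedyLeft (W : MorphismProperty A) (R : MorphismProperty M) {X Y : A ⥤ M} (q : X ⟶ Y) : Prop :=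
  ∀ (c : A) ⦃E F : M⦄ (p : E ⟶ F), R p → LatchingLift W q c p

lemma reedyRight_op_iff (W : MorphismProperty A) (R : MorphismProperty M) {X Y : A ⥤ M}
    (q : X ⟶ Y) : ReedyRight W.op R.op (NatTrans.op q) ↔ ReedyLeft W R q :=
  ⟨fun H c _ _ p hp => (matchingLift_op_iff W q c p).1 (H _ p.op hp),
    fun H c _ _ p hp => (matchingLift_op_iff W q c.unop p.unop).2 (H _ p.unop hp)⟩

variable {W₁ W₂ : MorphismProperty A} [W₁.IsMultiplicative]
  [W₂.IsMultiplicative] (r : ReedyStructure W₁ W₂ Ordinal.{w}) (L R : MorphismProperty M)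
  [L.IsWeakFactorizationSystem R]

include r

theorem hasLiftingProperty_of_reedy [HasColimits M] {X Y P Q : A ⥤ M} (q : X ⟶ Y) (p : P ⟶ Q)
    (hq : ReedyLeft W₂ R q) (hp : ReedyRight W₁ L p) : HasLiftingProperty q p :=
  hasLiftingProperty_of_matchingLift r q p fun c =>
    ⟨_, _, isRelativeLatching q W₂ c, hp c _ (by
      rw [← MorphismProperty.llp_eq_of_wfs L R]
      intro E F p' hp'
      exact (hasLiftingProperty_relativeLatchingMap_iff W₂ q ⟨c⟩ p').2 (hq c p' hp'))⟩

theorem reedyLeft_of_hasLiftingProperty [HasLimits M] {X Y : A ⥤ M} (q : X ⟶ Y)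
    (H : ∀ {P Q : A ⥤ M} (p : P ⟶ Q), ReedyRight W₁ L p → HasLiftingProperty q p) :
    ReedyLeft W₂ R q := fun c _ _ p hp =>
  latchingLift_of_forall_hasLiftingProperty r q c p fun ψ hψ => H ψ fun c _ _ i hi =>
    hψ c i (MorphismProperty.hasLiftingProperty_of_wfs i p hi hp)

/-- The recognition theorem for latching lifts is applied to the opposite Reedy structure, where its
test maps are opposites of Reedy left maps. -/
theorem reedyRight_of_hasLiftingProperty [HasColimits M] {P Q : A ⥤ M} (p : P ⟶ Q)
    (H : ∀ {X Y : A ⥤ M} (q : X ⟶ Y), ReedyLeft W₂ R q → HasLiftingProperty q p) :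
    ReedyRight W₁ L p := fun c _ _ i hi =>
  (latchingLift_op_iff W₁ p c i).1 <|
    latchingLift_of_forall_hasLiftingProperty r.op (NatTrans.op p) _ i.op fun {G K} ψ hψ => by
      have := H (NatTrans.unop ψ) fun c _ _ p' hp' =>
        (matchingLift_op_iff W₂ (NatTrans.unop ψ) c p').1 (hψ _ p'.op
          (MorphismProperty.hasLiftingProperty_of_wfs i p' hi hp').op)
      exact hasLiftingProperty_natTrans_op (NatTrans.unop ψ) p

end

/-! ### Reedy fibrations and cofibrations that are objectwise weak equivalences -/

section

variable {C : Type w} [SmallCategory C] (deg : C → Ordinal.{w})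
  (lt : ∀ ⦃a b : C⦄ (g : a ⟶ b), nonIds ⊤ g → deg b < deg a) {M : Type u} [Category.{w} M]

include lt in
-- A lift is a compatible family over the nonidentity morphisms out of c, so it is obtained by
-- extension from the empty cosieve.
theorem hasLiftingProperty_matchingMap [HasLimits M] {X Y : C ⥤ M} (p : X ⟶ Y) (c : C) {U V : M}
    (i : U ⟶ V) (H : ∀ ⦃d : C⦄ (g : c ⟶ d), nonIds ⊤ g → MatchingLift ⊤ p d i) :
    HasLiftingProperty i (matchingMap p c) := by
  refine ⟨fun {s t} sq => ?_⟩
  have le ⦃a b : C⦄ (g : a ⟶ b) : deg b ≤ deg a := by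
    by_cases hg : MorphismProperty.identities C g
    · obtain ⟨⟩ := hg
      rfl
    · exact (lt g ⟨trivial, hg⟩).le
  have comp ⦃d e : C⦄ (g : c ⟶ d) (h : d ⟶ e) (hg : nonIds ⊤ g) : nonIds ⊤ (g ≫ h) :=
    ⟨trivial, fun H => absurd ((le h).trans_lt (lt g hg)) (by
      have : ∀ ⦃a b : C⦄ (k : a ⟶ b), MorphismProperty.identities C k → ¬ deg b < deg a := by
        rintro a b k ⟨⟩
        exact lt_irrefl _
      exact this _ H)⟩
  obtain ⟨l, h1, h2, -, h4⟩ := exists_extension ⊤ deg lt p c i (fun d g => nonIds ⊤ g)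
    (fun d g => False) (fun d e g h hg _ => comp g h hg) (fun d e g h hg _ => hg)
    (fun d g hg _ => H g hg)
    (fun d g hg => s ≫ matchingProj X g hg) (fun d g hg => t ≫ matchingProj Y g hg)
    (fun d g hg => hg.elim)
    (fun d g hg => by
      rw [Category.assoc, ← matchingMap_matchingProj, ← reassoc_of% sq.w])
    (fun d e g hg h _ => by
      rw [Category.assoc, matchingProj_map])
    (fun d e g hg h _ => by
      rw [Category.assoc, matchingProj_map])
    (fun d e g hg => hg.elim) (fun d g hg => hg.elim) (fun d g hg => hg.elim)
  obtain ⟨k, hk⟩ := exists_matchingObj_lift l (fun d e g hg h hgh => h4 g hg h trivial)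
  refine ⟨⟨⟨k, ?_, ?_⟩⟩⟩
  · apply matchingObj_hom_ext
    intro d g hg
    rw [Category.assoc, hk, h1]
  · apply matchingObj_hom_ext
    intro d g hg
    rw [Category.assoc, matchingMap_matchingProj, ← Category.assoc, hk, h2]

end

section

variable {A : Type w} [SmallCategory A] {W₁ W₂ : MorphismProperty A} [W₁.IsMultiplicative]
  [W₂.IsMultiplicative] (r : ReedyStructure W₁ W₂ Ordinal.{w})

include r in
-- Extend from the empty cosieve to all inverse morphisms out of c and evaluate at the identity.
theorem hasLiftingProperty_app_of_matchingLift {M : Type*} [Category* M] {X Y : A ⥤ M} (p : X ⟶ Y)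
    {U V : M} (i : U ⟶ V) (H : ∀ c, MatchingLift W₁ p c i) (c : A) :
    HasLiftingProperty i (p.app c) := by
  refine ⟨fun {s t} sq => ?_⟩
  obtain ⟨l, h1, h2, -, -⟩ := exists_extension W₁ r.deg (fun a b g hg => r.lt₁ g hg.1 hg.2) p c i
    (fun d g => W₁ g) (fun d g => False) (fun d e g h hg hh => W₁.comp_mem _ _ hg hh)
    (fun d e g h hg _ => hg) (fun d g hg _ => H d)
    (fun d g hg => s ≫ X.map g) (fun d g hg => t ≫ Y.map g) (fun d g hg => hg.elim)
    (fun d g hg => by rw [Category.assoc, p.naturality, reassoc_of% sq.w])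
    (fun d e g hg h _ => by rw [Category.assoc, X.map_comp])
    (fun d e g hg h _ => by rw [Category.assoc, Y.map_comp])
    (fun d e g hg => hg.elim) (fun d g hg => hg.elim) (fun d g hg => hg.elim)
  exact ⟨⟨⟨l (𝟙 c) (W₁.id_mem c), by simpa using h1 (𝟙 c) (W₁.id_mem c),
    by simpa using h2 (𝟙 c) (W₁.id_mem c)⟩⟩⟩

variable {M : Type u} [Category.{w} M] [ModelCategory M]

include r in
theorem weakEquivalences_app_of_reedyRight {X Y : A ⥤ M} (p : X ⟶ Y)
    (H : ReedyRight W₁ (cofibrations M) p) (c : A) : weakEquivalences M (p.app c) := by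
  have : trivialFibrations M (p.app c) := by
    rw [← MorphismProperty.rlp_eq_of_wfs (cofibrations M) (trivialFibrations M)]
    intro U V i hi
    exact hasLiftingProperty_app_of_matchingLift r p i (fun c => H c i hi) c
  exact this.2

include r in
-- By induction on the degree the map of matching objects at c is a trivial fibration, hence so is
-- its base change to Y c. The relative matching map followed by this base change is `p.app c`, so
-- two-out-of-three makes the relative matching map a weak equivalence.
theorem reedyRight_cofibrations [HasLimits M] {X Y : A ⥤ M} (p : X ⟶ Y)
    (H : ReedyRight W₁ (trivialCofibrations M) p) (hp : ∀ c, weakEquivalences M (p.app c)) :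
    ReedyRight W₁ (cofibrations M) p := by
  intro c
  induction h : r.deg c using WellFoundedLT.induction generalizing c with
  | _ o ih =>
  subst h
  intro U V i hi
  let D := wideSubcategoryInclusion W₁
  let p' := Functor.whiskerLeft D p
  have fib : fibrations M (relativeMatchingMap p' ⟨c⟩) := by
    rw [← MorphismProperty.rlp_eq_of_wfs (trivialCofibrations M) (fibrations M)]
    intro U V i hi
    exact (hasLiftingProperty_relativeMatchingMap_iff W₁ p ⟨c⟩ i).2 (H c i hi)
  have tf : trivialFibrations M (matchingMap p' ⟨c⟩) := by
    rw [← MorphismProperty.rlp_eq_of_wfs (cofibrations M) (trivialFibrations M)]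
    intro U V i hi
    have lt : ∀ ⦃a b : WideSubcategory W₁⦄ (g : a ⟶ b), nonIds ⊤ g → r.deg b.obj < r.deg a.obj :=
      fun a b g hg => r.lt₁ g.hom g.property ((WideSubcategory.nonIds_top_iff W₁ g).1 hg).2
    exact hasLiftingProperty_matchingMap (fun a => r.deg a.obj) lt p' ⟨c⟩ i
      (fun d g hg => (matchingLift_whiskerLeft_iff W₁ p d i).2
        (ih _ (lt g hg) d.obj rfl i hi))
  have tf' : trivialFibrations M (pullback.snd (matchingMap p' ⟨c⟩) (objToMatching (D ⋙ Y) ⟨c⟩)) :=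
    MorphismProperty.pullback_snd _ _ tf
  have e := relativeMatchingMap_snd p' (c := ⟨c⟩)
  have we : weakEquivalences M (relativeMatchingMap p' ⟨c⟩) :=
    MorphismProperty.of_postcomp _ _ _ tf'.2 (by rw [e]; exact hp c)
  have : trivialFibrations M (relativeMatchingMap p' ⟨c⟩) := ⟨fib, we⟩
  exact (hasLiftingProperty_relativeMatchingMap_iff W₁ p ⟨c⟩ i).1
    (MorphismProperty.hasLiftingProperty_of_wfs i _ hi this)

include r in
theorem weakEquivalences_app_of_reedyLeft {X Y : A ⥤ M} (q : X ⟶ Y)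
    (H : ReedyLeft W₂ (fibrations M) q) (c : A) : weakEquivalences M (q.app c) :=
  weakEquivalences_app_of_reedyRight r.op (NatTrans.op q) ((reedyRight_op_iff W₂ _ q).2 H)
    (Opposite.op c)

include r in
theorem reedyLeft_fibrations [HasColimits M] {X Y : A ⥤ M} (q : X ⟶ Y)
    (H : ReedyLeft W₂ (trivialFibrations M) q) (hq : ∀ c, weakEquivalences M (q.app c)) :
    ReedyLeft W₂ (fibrations M) q :=
  (reedyRight_op_iff W₂ _ q).1 <|
    reedyRight_cofibrations r.op (NatTrans.op q) ((reedyRight_op_iff W₂ _ q).2 H)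
      (fun c => hq c.unop)

end

/-! ### Connected factorizations and preservation of matching lifts under restriction -/

/-- Any two factorizations of `σ : f α ⟶ β` as `f g ≫ t`, with `g` a nonidentity morphism of `V`
and `t` in `W`, are connected by morphisms in `V`. -/
def FactorizationsConnected {A B : Type*} [Category* A] [Category* B] (V : MorphismProperty A)
    (W : MorphismProperty B) (f : A ⥤ B) {α : A} {β : B} (σ : f.obj α ⟶ β) : Prop :=
  ∀ F : (∀ ⦃γ : A⦄ (g : α ⟶ γ) (t : f.obj γ ⟶ β), nonIds V g → W t → f.map g ≫ t = σ → Prop),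
    (∀ ⦃γ γ' : A⦄ (g : α ⟶ γ) (h : γ ⟶ γ') (t : f.obj γ' ⟶ β) (hg : nonIds V g) (_ : V h)
      (hgh : nonIds V (g ≫ h)) (ht : W t) (hht : W (f.map h ≫ t)) (e : f.map g ≫ f.map h ≫ t = σ)
      (e' : f.map (g ≫ h) ≫ t = σ),
      F g (f.map h ≫ t) hg hht e ↔ F (g ≫ h) t hgh ht e') →
    ∀ ⦃γ γ' : A⦄ (g : α ⟶ γ) (g' : α ⟶ γ') (t : f.obj γ ⟶ β) (t' : f.obj γ' ⟶ β) (hg : nonIds V g)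
      (hg' : nonIds V g') (ht : W t) (ht' : W t') (e : f.map g ≫ t = σ) (e' : f.map g' ≫ t' = σ),
      F g t hg ht e → F g' t' hg' ht' e'

section

variable {A B : Type*} [Category* A] [Category* B] (V : MorphismProperty A)
    (W : MorphismProperty B) [W.IsMultiplicative] (f : A ⥤ B)
    (hf : ∀ ⦃x y : A⦄ (g : x ⟶ y), V g → W (f.map g))
    (degB : B → Ordinal.{w}) (ltB : ∀ ⦃a b : B⦄ (g : a ⟶ b), nonIds W g → degB b < degB a)
    {M : Type*} [Category* M]

include hf ltB in
theorem matchingLift_whiskerLeft_of_factorizationsConnected {X Y : B ⥤ M} (p : X ⟶ Y) (α : A)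
    (hc : ∀ ⦃β : B⦄ (σ : f.obj α ⟶ β), W σ → FactorizationsConnected V W f σ) {K N : M} (i : K ⟶ N)
    (H : ∀ β, MatchingLift W p β i) : MatchingLift V (Functor.whiskerLeft f p) α i := by
  intro u y x h1 h2 h3 h4
  let T : ∀ ⦃β : B⦄, (f.obj α ⟶ β) → Prop := fun β σ =>
    ∃ (γ : A) (g : α ⟶ γ) (t : f.obj γ ⟶ β), nonIds V g ∧ W t ∧ f.map g ≫ t = σ
  have hT ⦃β : B⦄ (σ : f.obj α ⟶ β) (hσ : T σ) : ∃ k : N ⟶ X.obj β,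
      ∀ ⦃γ : A⦄ (g : α ⟶ γ) (t : f.obj γ ⟶ β) (hg : nonIds V g) (_ : W t), f.map g ≫ t = σ →
        k = x g hg ≫ X.map t := by
    obtain ⟨γ, g, t, hg, ht, e⟩ := hσ
    refine ⟨x g hg ≫ X.map t, fun γ' g' t' hg' ht' e' => ?_⟩
    have hW : W σ := by rw [← e]; exact W.comp_mem _ _ (hf g hg.1) ht
    -- The locally constant predicate is "this factorization induces the same map N ⟶ X β as the
    -- chosen one".
    exact hc σ hW (fun γ' g' t' hg' _ _ => x g hg ≫ X.map t = x g' hg' ≫ X.map t')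
      (fun γ γ' g₁ h t hg hh hgh _ _ _ _ => by
        rw [← h4 g₁ hg h hh hgh, X.map_comp, Category.assoc]
        rfl) g g' t t' hg hg' ht ht' e e' rfl
  choose k hk using hT
  obtain ⟨l, l1, l2, l3, l4⟩ := exists_extension W degB ltB p (f.obj α) i (fun β σ => W σ) T
    (fun β γ g h hg hh => W.comp_mem _ _ hg hh)
    (fun β γ σ h ⟨δ, g, t, hg, ht, e⟩ hh =>
      ⟨δ, g, t ≫ h, hg, W.comp_mem _ _ ht hh, by rw [← e, Category.assoc]⟩)
    (fun β _ _ _ => H β)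
    (fun β σ _ => u ≫ X.map σ) (fun β σ _ => y ≫ Y.map σ) k
    (fun β σ _ => by
      rw [Category.assoc, p.naturality, reassoc_of% h1]
      rfl)
    (fun β γ σ _ h _ => by rw [Category.assoc, X.map_comp])
    (fun β γ σ _ h _ => by rw [Category.assoc, Y.map_comp])
    (fun β γ σ ⟨δ, g, t, hg, ht, e⟩ h hh => by
      rw [hk σ _ g t hg ht e, hk (σ ≫ h) _ g (t ≫ h) hg (W.comp_mem _ _ ht hh)
        (by rw [← e, Category.assoc]), X.map_comp, Category.assoc])
    (fun β σ ⟨δ, g, t, hg, ht, e⟩ _ => by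
      rw [hk σ _ g t hg ht e, reassoc_of% (h2 g hg), ← e, X.map_comp])
    (fun β σ ⟨δ, g, t, hg, ht, e⟩ _ => by
      rw [hk σ _ g t hg ht e, Category.assoc, p.naturality, ← e, Y.map_comp,
        ← reassoc_of% (show y ≫ Y.map (f.map g) = x g hg ≫ p.app _ from (h3 g hg).symm)])
  refine ⟨l (𝟙 _) (W.id_mem _), ?_, ?_, fun γ g hg => ?_⟩
  · exact (l1 _ _).trans ((congrArg (u ≫ ·) (X.map_id _)).trans (Category.comp_id u))
  · exact (l2 _ _).trans ((congrArg (y ≫ ·) (Y.map_id _)).trans (Category.comp_id y))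
  · have hgT : T (𝟙 _ ≫ f.map g) := ⟨γ, g, 𝟙 _, hg, W.id_mem _, by simp⟩
    refine (l4 (𝟙 _) (W.id_mem _) (f.map g) (hf g hg.1)).trans ?_
    rw [l3 _ _ hgT, hk _ hgT g (𝟙 _) hg (W.id_mem _) (by simp)]
    exact (congrArg (x g hg ≫ ·) (X.map_id _)).trans (Category.comp_id (x g hg))

end

section

variable {A B : Type w} [SmallCategory A] [SmallCategory B] {V : MorphismProperty A}
    {W₁ W₂ : MorphismProperty B} [W₁.IsMultiplicative] [W₂.IsMultiplicative]
    (r : ReedyStructure W₁ W₂ Ordinal.{w}) (f : A ⥤ B)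
    (hf : ∀ ⦃x y : A⦄ (g : x ⟶ y), V g → W₁ (f.map g))
    {M : Type u} [Category.{w} M] [HasLimits M]

/-- The functor `E^{B(-, β)}` with its morphism to the terminal functor. -/
noncomputable def cofreeToTerminal (β : B) (E : M) :
    prodFunctor ((Functor.const (Over β)).obj E) ⟶
      prodFunctor ((Functor.const (Over β)).obj (⊤_ M)) :=
  prodMap ((Functor.const (Over β)).map (terminal.from E))

include r in
theorem matchingLift_cofreeToTerminal (β : B) {E N K : M} (i : N ⟶ K)
    [HasLiftingProperty i (terminal.from E)] (c : B) :
    MatchingLift W₁ (cofreeToTerminal β E) c i :=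
  matchingLift_prodMap r _ i (fun _ _ _ _ _ => inferInstanceAs (Mono (𝟙 (⊤_ M))))
    (fun _ _ _ => inferInstanceAs (HasLiftingProperty i (terminal.from E))) c

include r hf in
-- Maps into the cofree diagram are families indexed by morphisms to β. A predicate F constant along
-- morphisms of factorizations gives matching data with component a where F holds and b elsewhere;
-- for a lift, the component at every factorization of σ equals the single component of the lift at
-- σ, so F cannot change value.
theorem factorizationsConnected_of_matchingLift {α : A} {β : B} (σ : f.obj α ⟶ β)
    {E N K : M} (i : N ⟶ K) (a b : K ⟶ E) (hab : a ≠ b) (hi : i ≫ a = i ≫ b)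
    (H : MatchingLift V (Functor.whiskerLeft f (cofreeToTerminal β E)) α i) :
    FactorizationsConnected V W₁ f σ := by
  classical
  intro F hF γ₀ γ₁ g₀ g₁ t₀ t₁ hg₀ hg₁ ht₀ ht₁ e₀ e₁ F₀
  let Q := (Functor.const (Over β)).obj E
  have hext ⦃Z : M⦄ ⦃c : B⦄ (s t : Z ⟶ (prodFunctor ((Functor.const (Over β)).obj (⊤_ M))).obj c) :
      s = t := prodFunctor_hom_ext fun h => Subsingleton.elim (α := Z ⟶ ⊤_ M) _ _
  let P ⦃γ : A⦄ (g : α ⟶ γ) (hg : nonIds V g) (t : f.obj γ ⟶ β) : Prop :=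
    ∃ (ht : W₁ t) (e : f.map g ≫ t = σ), F g t hg ht e
  let c ⦃γ : A⦄ (g : α ⟶ γ) (hg : nonIds V g) (t : f.obj γ ⟶ β) : K ⟶ E :=
    if P g hg t then a else b
  have hc ⦃γ : A⦄ (g : α ⟶ γ) (hg : nonIds V g) (t : f.obj γ ⟶ β) : i ≫ c g hg t = i ≫ a := by
    by_cases h : P g hg t
    · simp [c, h]
    · simp [c, h, hi]
  have mapProj {c d : B} (k : c ⟶ d) (h : d ⟶ β) :
      (prodFunctor Q).map k ≫ prodProj Q h = prodProj Q (k ≫ h) :=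
    (prodFunctor_map_prodProj Q k h _ rfl).trans (Category.comp_id _)
  obtain ⟨l, -, -, h3⟩ := H (prodLift Q fun h => i ≫ a) (prodLift _ fun h => terminal.from K)
    (fun γ g hg => prodLift Q (c g hg)) (hext _ _)
    (fun γ g hg => by
      apply prodFunctor_hom_ext
      intro h
      rw [Category.assoc, prodLift_prodProj, Category.assoc]
      refine (hc g hg h).trans ?_
      refine Eq.trans ?_ (congrArg _ (mapProj (f.map g) h)).symm
      rw [prodLift_prodProj])
    (fun γ g hg => hext _ _)
    (fun γ δ g hg h hh hgh => by
      apply prodFunctor_hom_ext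
      intro t
      rw [Category.assoc, prodLift_prodProj]
      refine (congrArg _ (mapProj (f.map h) t)).trans ?_
      rw [prodLift_prodProj]
      -- Compatibility requires membership of `t` and of `f.map h ≫ t` in `W₁` to be equivalent; one
      -- direction is `of_comp₁`.
      have : P g hg (f.map h ≫ t) ↔ P (g ≫ h) hgh t := by
        constructor
        · rintro ⟨h1, h2, h3⟩
          have h4 := r.of_comp₁ _ _ h1
          have h5 : f.map (g ≫ h) ≫ t = σ := by rw [f.map_comp, Category.assoc, h2]
          exact ⟨h4, h5, (hF g h t hg hh hgh h4 h1 h2 h5).1 h3⟩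
        · rintro ⟨h1, h2, h3⟩
          have h4 := W₁.comp_mem _ _ (hf h hh) h1
          have h5 : f.map g ≫ f.map h ≫ t = σ := by rw [← h2, f.map_comp, Category.assoc]
          exact ⟨h4, h5, (hF g h t hg hh hgh h1 h4 h5 h2).2 h3⟩
      simp only [c, this])
  have key ⦃γ : A⦄ (g : α ⟶ γ) (hg : nonIds V g) (t : f.obj γ ⟶ β) (e : f.map g ≫ t = σ) :
      c g hg t = l ≫ prodProj Q σ := by
    have := h3 g hg =≫ prodProj Q t
    rw [prodLift_prodProj, Category.assoc] at this
    rw [← this, ← e]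
    exact congrArg _ (mapProj (f.map g) t)
  have h5 : c g₀ hg₀ t₀ = c g₁ hg₁ t₁ := (key g₀ hg₀ t₀ e₀).trans (key g₁ hg₁ t₁ e₁).symm
  have h6 : P g₀ hg₀ t₀ := ⟨ht₀, e₀, F₀⟩
  by_cases h7 : P g₁ hg₁ t₁
  · exact h7.2.2
  · simp only [c, h6, h7, if_true, if_false] at h5
    exact (hab h5).elim

end

/-! ### A model category with a test object -/

/-- There is an object `E` that is injective with respect to trivial
cofibrations, with two different morphisms to it that agree on a trivial cofibration. -/
def HasTestObject (M : Type*) [Category* M] [ModelCategory M] : Prop :=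
  ∃ (E N K : M) (i : N ⟶ K) (a b : K ⟶ E), trivialCofibrations M i ∧ a ≠ b ∧ i ≫ a = i ≫ b ∧
    ∀ ⦃N' K' : M⦄ (j : N' ⟶ K') (g : N' ⟶ E), trivialCofibrations M j → ∃ h : K' ⟶ E, j ≫ h = g

lemma HasTestObject.op_op {M : Type*} [Category* M] [ModelCategory M] (h : HasTestObject M) :
    HasTestObject Mᵒᵖᵒᵖ := by
  obtain ⟨E, N, K, i, a, b, hi, hab, hiab, H⟩ := h
  refine ⟨.op (.op E), .op (.op N), .op (.op K), i.op.op, a.op.op, b.op.op, hi, fun h => hab ?_,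
    congrArg (fun k => k.op.op) hiab, fun N' K' j g hj => ?_⟩
  · exact congrArg (fun k => k.unop.unop) h
  · obtain ⟨h, hh⟩ := H j.unop.unop g.unop.unop hj
    exact ⟨h.op.op, congrArg (fun k => k.op.op) hh⟩

section

variable {T : Type u} [Category.{w} T]

lemma hasLiftingProperty_types {X Y P Q : Type w} (i : X ⟶ Y) (p : P ⟶ Q) [Mono i] [Epi p] :
    HasLiftingProperty i p := by
  classical
  have hi := (mono_iff_injective i).1 inferInstance
  have hp := (epi_iff_surjective p).1 inferInstance
  refine ⟨fun {u v} sq => ?_⟩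
  have w (x : X) : p (u x) = v (i x) := ConcreteCategory.congr_hom sq.w x
  let l : Y → P := fun y => if h : ∃ x, i x = y then u h.choose else (hp (v y)).choose
  have hl (x : X) : l (i x) = u x := by
    have h : ∃ x', i x' = i x := ⟨x, rfl⟩
    have h1 : l (i x) = u h.choose := dif_pos h
    rw [h1, hi h.choose_spec]
  refine ⟨⟨⟨TypeCat.ofHom l, ?_, ?_⟩⟩⟩
  · ext x
    exact hl x
  · ext y
    by_cases h : ∃ x, i x = y
    · obtain ⟨x, rfl⟩ := h
      change p (l (i x)) = _
      rw [hl, w]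
      rfl
    · have h1 : l y = (hp (v y)).choose := dif_neg h
      change p (l y) = _
      rw [h1]
      exact (hp (v y)).choose_spec

/-- A map X ⟶ Y factors through X ⨿ Y, and in sets lifts of injections against surjections come from
choice. -/
lemma isWeakFactorizationSystem_mono_epi (e : T ≌ Type w) :
    (MorphismProperty.monomorphisms T).IsWeakFactorizationSystem
      (MorphismProperty.epimorphisms T) := by
  have : HasColimitsOfSize.{0, 0} T := Adjunction.has_colimits_of_equivalence e.functor
  have : MonoCoprod T := MonoCoprod.monoCoprod_of_preservesCoprod_of_reflectsMono e.functor
  have : (MorphismProperty.monomorphisms T).HasFactorization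
      (MorphismProperty.epimorphisms T) :=
    ⟨fun {X Y} f => ⟨{
      Z := X ⨿ Y
      i := coprod.inl
      p := coprod.desc f (𝟙 Y)
      fac := coprod.inl_desc _ _
      hi := inferInstanceAs (Mono coprod.inl)
      hp := (epi_of_epi_fac (coprod.inr_desc f (𝟙 Y)) : Epi (coprod.desc f (𝟙 Y))) }⟩⟩
  refine MorphismProperty.IsWeakFactorizationSystem.mk' _ _ fun i p hi hp => ?_
  have : Mono i := hi
  have : Epi p := hp
  exact (e.functor.hasLiftingProperty_iff_of_isEquivalence i p).1 (hasLiftingProperty_types _ _)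

/-- With every map a weak equivalence, both factorization systems are (mono, epi). The two points of
a two-element set agree on the inclusion of the empty set, and a nonempty set is injective. -/
theorem exists_modelCategory_hasTestObject (e : T ≌ Type w) :
    ∃ _ : ModelCategory T, HasTestObject T := by
  have : HasLimitsOfSize.{0, 0} T := Adjunction.has_limits_of_equivalence e.functor
  have : HasColimitsOfSize.{0, 0} T := Adjunction.has_colimits_of_equivalence e.functor
  have wfs := isWeakFactorizationSystem_mono_epi e
  let _ : CategoryWithCofibrations T := ⟨MorphismProperty.monomorphisms T⟩
  let _ : CategoryWithFibrations T := ⟨MorphismProperty.epimorphisms T⟩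
  let _ : CategoryWithWeakEquivalences T := ⟨⊤⟩
  have hcof : cofibrations T = MorphismProperty.monomorphisms T := rfl
  have hfib : fibrations T = MorphismProperty.epimorphisms T := rfl
  have hweq : weakEquivalences T = ⊤ := rfl
  have htcof : trivialCofibrations T = MorphismProperty.monomorphisms T := by
    rw [trivialCofibrations, hcof, hweq, inf_top_eq]
  have htfib : trivialFibrations T = MorphismProperty.epimorphisms T := by
    rw [trivialFibrations, hfib, hweq, inf_top_eq]
  have : (weakEquivalences T).HasTwoOutOfThreeProperty := by
    rw [hweq]
    infer_instance
  have : (cofibrations T).IsWeakFactorizationSystem (trivialFibrations T) := by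
    rw [hcof, htfib]
    exact wfs
  have : (trivialCofibrations T).IsWeakFactorizationSystem (fibrations T) := by
    rw [htcof, hfib]
    exact wfs
  let mc : ModelCategory T := ModelCategory.mk' T
  refine ⟨mc, ?_⟩
  let E : Type w := ULift Bool
  let N : Type w := PEmpty
  let K : Type w := PUnit
  let i : N ⟶ K := TypeCat.ofHom fun _ => PUnit.unit
  let a : K ⟶ E := TypeCat.ofHom fun _ => ⟨true⟩
  let b : K ⟶ E := TypeCat.ofHom fun _ => ⟨false⟩
  have hi : Mono i := (mono_iff_injective i).2 fun x => x.elim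
  have hab : a ≠ b := fun h => by
    have h1 : a PUnit.unit = b PUnit.unit := by rw [h]
    exact absurd (congrArg ULift.down h1) (by simp [a, b])
  have hiab : i ≫ a = i ≫ b := by
    ext x
    exact x.elim
  refine ⟨e.inverse.obj E, _, _, e.inverse.map i, e.inverse.map a, e.inverse.map b, ?_,
    fun h => hab (e.inverse.map_injective h), by rw [← Functor.map_comp, hiab, Functor.map_comp],
    fun N' K' j g hj => ?_⟩
  · change trivialCofibrations T _
    rw [htcof]
    exact inferInstanceAs (Mono (e.inverse.map i))
  · change trivialCofibrations T j at hj
    rw [htcof] at hj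
    -- A point of the two-element set makes its map to the terminal object a split epimorphism,
    -- hence a fibration.
    let s : ⊤_ T ⟶ e.inverse.obj E := e.toAdjunction.homEquiv _ _ (TypeCat.ofHom fun _ => ⟨true⟩)
    have hs : s ≫ terminal.from _ = 𝟙 _ := Subsingleton.elim _ _
    have : Epi (terminal.from (e.inverse.obj E)) := epi_of_epi_fac hs
    have := MorphismProperty.hasLiftingProperty_of_wfs (W₁ := MorphismProperty.monomorphisms T)
      (W₂ := MorphismProperty.epimorphisms T) j (terminal.from (e.inverse.obj E)) hj this
    have sq : CommSq g j (terminal.from (e.inverse.obj E)) (terminal.from K') :=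
      ⟨Subsingleton.elim _ _⟩
    exact ⟨sq.lift, sq.fac_left⟩

end

/-- Lifting the collection of objects of `Type w` places the example in the universe over which the
definitions of left and right fibration quantify. -/
theorem exists_hasTestObject : ∃ (M : Type (max u (w + 1))) (_ : Category.{w} M)
    (_ : ModelCategory M), HasLimits M ∧ HasColimits M ∧ HasTestObject M := by
  let _ : Category.{w} (ULift.{u} (Type w)) := uliftCategory (Type w)
  let e : ULift.{u} (Type w) ≌ Type w := ULift.equivalence.symm
  obtain ⟨mc, h⟩ := exists_modelCategory_hasTestObject e
  exact ⟨_, _, mc, Adjunction.has_limits_of_equivalence e.functor,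
    Adjunction.has_colimits_of_equivalence e.functor, h⟩

/-! ### Connectedness of nerves and the factorization condition -/

/-- Predicates constant along morphisms are functions from π₀ of the nerve to `Prop`, and these
separate components; stating it so avoids zigzags and covers the empty case. -/
theorem nerveEmptyOrConnected_iff {J : Type w} [SmallCategory J] :
    NerveEmptyOrConnected J ↔ ∀ F : J → Prop, (∀ ⦃j j' : J⦄, (j ⟶ j') → (F j ↔ F j')) →
      ∀ j j' : J, F j → F j' := by
  constructor
  · rintro (h | h) F hF j j' hj
    · exact (h ⟨nerveEquiv.symm j⟩).elim
    · let φ : SSet.π₀ (nerve J) → Prop :=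
        SSet.π₀.lift (X := nerve J) (fun x => F (nerveEquiv x))
          (fun x₀ x₁ e => propext (hF (nerve.homEquiv e)))
      have : (SSet.π₀.mk (X := nerve J) (nerveEquiv.symm j)) =
          SSet.π₀.mk (nerveEquiv.symm j') := Subsingleton.elim _ _
      have := congrArg φ this
      change F j = F j' at this
      exact this ▸ hj
  · intro H
    by_cases h : (nerve J).Nonempty
    · refine Or.inr ((SSet.isConnected_iff _).2 ⟨⟨fun x y => ?_⟩, h⟩)
      obtain ⟨x, rfl⟩ := x.mk_surjective
      obtain ⟨y, rfl⟩ := y.mk_surjective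
      have hz (z : ComposableArrows J 0) : SSet.π₀.mk (X := nerve J)
          (nerveEquiv.symm (nerveEquiv z)) =
          SSet.π₀.mk z := congrArg _ (nerveEquiv.symm_apply_apply z)
      exact (H (fun j => SSet.π₀.mk (X := nerve J) x = SSet.π₀.mk (nerveEquiv.symm j))
        (fun j j' k => by rw [SSet.π₀.sound (nerve.edgeMk k)]) (nerveEquiv x) (nerveEquiv y)
        (hz x).symm).trans (hz y)
    · exact Or.inl h

section

variable {C D : Type*} [Category* C] [Category* D]

/-- The commuting triangle over an identity forces the two structure maps to agree. Hence
"nonidentity" means the same in the comma category and in C. -/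
lemma CostructuredArrow.identities_iff {F : C ⥤ D} {d : D} {x y : CostructuredArrow F d}
    (k : x ⟶ y) : MorphismProperty.identities _ k ↔ MorphismProperty.identities C k.left := by
  constructor
  · rintro ⟨_⟩
    exact ⟨_⟩
  · intro h
    obtain ⟨c, s, rfl⟩ := x.mk_surjective
    obtain ⟨c', t, rfl⟩ := y.mk_surjective
    obtain ⟨k, hk, rfl⟩ := CostructuredArrow.homMk_surjective k
    change MorphismProperty.identities C k at h
    obtain ⟨⟩ := h
    obtain rfl : s = t := by simpa using hk.symm
    exact ⟨CostructuredArrow.mk s⟩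

lemma StructuredArrow.identities_iff {F : C ⥤ D} {d : D} {x y : StructuredArrow d F}
    (k : x ⟶ y) : MorphismProperty.identities _ k ↔ MorphismProperty.identities C k.right := by
  constructor
  · rintro ⟨_⟩
    exact ⟨_⟩
  · intro h
    obtain ⟨c, s, rfl⟩ := x.mk_surjective
    obtain ⟨c', t, rfl⟩ := y.mk_surjective
    obtain ⟨k, hk, rfl⟩ := StructuredArrow.homMk_surjective k
    change MorphismProperty.identities C k at h
    obtain ⟨⟩ := h
    obtain rfl : s = t := by simpa using hk
    exact ⟨StructuredArrow.mk s⟩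

end

namespace ReedyMorphism

variable {A B : Type w} [SmallCategory A] [SmallCategory B] [ReedyCategory A] [ReedyCategory B]
  (f : ReedyMorphism A B)

section

variable {a : InvCat A} {b : InvCat B} (s : f.invFunctor.obj a ⟶ b)

/-- The object of `∂(a/(f^←/b))` given by a factorization of `s` as `f g ≫ t` with `g` not an
identity. -/
def matchingMk ⦃γ : A⦄ (g : a.obj ⟶ γ) (t : f.functor.obj γ ⟶ b.obj) (hg : nonIds invHoms g)
    (ht : invHoms t) (e : f.functor.map g ≫ t = s.hom) :
    MatchingCategory (CostructuredArrow.mk s : CostructuredArrow f.invFunctor b) where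
  obj := Under.mk (Y := CostructuredArrow.mk (S := f.invFunctor) (T := b) (Y := (⟨γ⟩ : InvCat A))
      (⟨t, ht⟩ : f.invFunctor.obj (⟨γ⟩ : InvCat A) ⟶ b))
    (CostructuredArrow.homMk (⟨g, hg.1⟩ : a ⟶ (⟨γ⟩ : InvCat A)) (WideSubcategory.hom_ext _ e))
  property h := ((WideSubcategory.nonIds_top_iff _ _).2 hg).2
    ((CostructuredArrow.identities_iff _).1 h)

variable {s}

lemma nonIds_matchingCategory
    (j : MatchingCategory (CostructuredArrow.mk s : CostructuredArrow f.invFunctor b)) :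
    nonIds invHoms j.obj.hom.left.hom :=
  (WideSubcategory.nonIds_top_iff _ _).1
    ⟨trivial, fun h => j.property ((CostructuredArrow.identities_iff _).2 h)⟩

lemma matchingCategory_w
    (j : MatchingCategory (CostructuredArrow.mk s : CostructuredArrow f.invFunctor b)) :
    f.functor.map j.obj.hom.left.hom ≫ j.obj.right.hom.hom = s.hom :=
  congrArg InducedWideCategory.Hom.hom (CostructuredArrow.w j.obj.hom)

variable (s)

/-- An object of the boundary category is a factorization of s with nonidentity first part, and its
morphisms are exactly the moves allowed in `FactorizationsConnected`. -/
theorem nerveEmptyOrConnected_matchingCategory_iff :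
    NerveEmptyOrConnected
      (MatchingCategory (CostructuredArrow.mk s : CostructuredArrow f.invFunctor b)) ↔
      FactorizationsConnected invHoms invHoms f.functor (α := a.obj) (β := b.obj) s.hom := by
  rw [nerveEmptyOrConnected_iff]
  have hj := f.nonIds_matchingCategory (s := s)
  have ej := f.matchingCategory_w (s := s)
  constructor
  · intro H F hF γ γ' g g' t t' hg hg' ht ht' e e'
    have F_congr ⦃γ : A⦄ (g g' : a.obj ⟶ γ) (t t' : f.functor.obj γ ⟶ b.obj)
        (hg : nonIds invHoms g) (hg' : nonIds invHoms g') (ht : invHoms t) (ht' : invHoms t')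
        (e : f.functor.map g ≫ t = s.hom) (e' : f.functor.map g' ≫ t' = s.hom)
        (h : g = g') (h' : t = t') : F g t hg ht e ↔ F g' t' hg' ht' e' := by
      subst h h'
      rfl
    refine H (fun j => F j.obj.hom.left.hom j.obj.right.hom.hom (hj j) j.obj.right.hom.property
      (ej j)) (fun j j' k => ?_) (f.matchingMk s g t hg ht e) (f.matchingMk s g' t' hg' ht' e')
    have h1 : j.obj.hom.left.hom ≫ k.hom.right.left.hom = j'.obj.hom.left.hom :=
      congrArg (fun l => l.left.hom) (Under.w k.hom)
    have h2 : f.functor.map k.hom.right.left.hom ≫ j'.obj.right.hom.hom = j.obj.right.hom.hom :=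
      congrArg InducedWideCategory.Hom.hom (CostructuredArrow.w k.hom.right)
    have h3 : nonIds invHoms (j.obj.hom.left.hom ≫ k.hom.right.left.hom) := by
      rw [h1]
      exact hj j'
    have h4 : invHoms (f.functor.map k.hom.right.left.hom ≫ j'.obj.right.hom.hom) := by
      rw [h2]
      exact j.obj.right.hom.property
    have h5 : f.functor.map j.obj.hom.left.hom ≫ f.functor.map k.hom.right.left.hom ≫
        j'.obj.right.hom.hom = s.hom := by
      rw [h2]
      exact ej j
    have h6 : f.functor.map (j.obj.hom.left.hom ≫ k.hom.right.left.hom) ≫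
        j'.obj.right.hom.hom = s.hom := by
      rw [h1]
      exact ej j'
    exact ((F_congr _ _ _ _ (hj j) (hj j) _ h4 (ej j) h5 rfl h2.symm).trans
      (hF j.obj.hom.left.hom k.hom.right.left.hom j'.obj.right.hom.hom (hj j)
        k.hom.right.left.property h3 j'.obj.right.hom.property h4 h5 h6)).trans
      (F_congr _ _ _ _ h3 (hj j') _ _ h6 (ej j') h1 rfl)
  · intro H G hG j j'
    refine H (fun γ g t hg ht e => G (f.matchingMk s g t hg ht e))
      (fun γ γ' g h t hg hh hgh ht hht e e' => hG (ObjectProperty.homMk (Under.homMk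
        (CostructuredArrow.homMk (⟨h, hh⟩ : (⟨γ⟩ : InvCat A) ⟶ ⟨γ'⟩)
          (WideSubcategory.hom_ext _ rfl)) ?_)))
      _ _ _ _ (hj j) (hj j') j.obj.right.hom.property j'.obj.right.hom.property (ej j) (ej j')
    exact CostructuredArrow.hom_ext _ _ (WideSubcategory.hom_ext _ rfl)

end

section

variable {a : DirCat A} {b : DirCat B} (s : b ⟶ f.dirFunctor.obj a)

/-- The object of `∂((b/f^→)/a)` given by a factorization of `s` as `t ≫ f g` with `g` not an
identity. -/
def latchingMk ⦃γ : A⦄ (g : γ ⟶ a.obj) (t : b.obj ⟶ f.functor.obj γ) (hg : nonIds dirHoms g)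
    (ht : dirHoms t) (e : t ≫ f.functor.map g = s.hom) :
    LatchingCategory (StructuredArrow.mk s : StructuredArrow b f.dirFunctor) where
  obj := Over.mk (Y := StructuredArrow.mk (T := f.dirFunctor) (S := b) (Y := (⟨γ⟩ : DirCat A))
      (⟨t, ht⟩ : b ⟶ f.dirFunctor.obj (⟨γ⟩ : DirCat A)))
    (StructuredArrow.homMk (⟨g, hg.1⟩ : (⟨γ⟩ : DirCat A) ⟶ a) (WideSubcategory.hom_ext _ e))
  property h := ((WideSubcategory.nonIds_top_iff _ _).2 hg).2
    ((StructuredArrow.identities_iff _).1 h)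

variable {s}

lemma nonIds_latchingCategory
    (j : LatchingCategory (StructuredArrow.mk s : StructuredArrow b f.dirFunctor)) :
    nonIds dirHoms j.obj.hom.right.hom :=
  (WideSubcategory.nonIds_top_iff _ _).1
    ⟨trivial, fun h => j.property ((StructuredArrow.identities_iff _).2 h)⟩

lemma latchingCategory_w
    (j : LatchingCategory (StructuredArrow.mk s : StructuredArrow b f.dirFunctor)) :
    j.obj.left.hom.hom ≫ f.functor.map j.obj.hom.right.hom = s.hom :=
  congrArg InducedWideCategory.Hom.hom (StructuredArrow.w j.obj.hom)

variable (s)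

theorem nerveEmptyOrConnected_latchingCategory_iff :
    NerveEmptyOrConnected
      (LatchingCategory (StructuredArrow.mk s : StructuredArrow b f.dirFunctor)) ↔
      FactorizationsConnected dirHoms.op dirHoms.op f.functor.op (α := .op a.obj) (β := .op b.obj)
        s.hom.op := by
  rw [nerveEmptyOrConnected_iff]
  have hj := f.nonIds_latchingCategory (s := s)
  have ej := f.latchingCategory_w (s := s)
  constructor
  · intro H F hF γ γ' g g' t t' hg hg' ht ht' e e'
    let F' ⦃γ : A⦄ (g : γ ⟶ a.obj) (t : b.obj ⟶ f.functor.obj γ) (hg : nonIds dirHoms g)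
        (ht : dirHoms t) (e : t ≫ f.functor.map g = s.hom) : Prop :=
      F g.op t.op ((nonIds_op_iff _ _).2 hg) ht (congrArg Quiver.Hom.op e)
    have F_congr ⦃γ : A⦄ (g g' : γ ⟶ a.obj) (t t' : b.obj ⟶ f.functor.obj γ)
        (hg : nonIds dirHoms g) (hg' : nonIds dirHoms g') (ht : dirHoms t) (ht' : dirHoms t')
        (e : t ≫ f.functor.map g = s.hom) (e' : t' ≫ f.functor.map g' = s.hom)
        (h : g = g') (h' : t = t') : F' g t hg ht e ↔ F' g' t' hg' ht' e' := by
      subst h h'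
      rfl
    refine H (fun j => F' j.obj.hom.right.hom j.obj.left.hom.hom (hj j) j.obj.left.hom.property
      (ej j)) (fun j j' k => ?_)
      (f.latchingMk s g.unop t.unop ((nonIds_op_iff _ _).1 hg) ht (congrArg Quiver.Hom.unop e))
      (f.latchingMk s g'.unop t'.unop ((nonIds_op_iff _ _).1 hg') ht' (congrArg Quiver.Hom.unop e'))
    have h1 : k.hom.left.right.hom ≫ j'.obj.hom.right.hom = j.obj.hom.right.hom :=
      congrArg (fun l => l.right.hom) (Over.w k.hom)
    have h2 : j.obj.left.hom.hom ≫ f.functor.map k.hom.left.right.hom = j'.obj.left.hom.hom :=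
      congrArg InducedWideCategory.Hom.hom (StructuredArrow.w k.hom.left)
    have h3 : nonIds dirHoms (k.hom.left.right.hom ≫ j'.obj.hom.right.hom) := by
      rw [h1]
      exact hj j
    have h4 : dirHoms (j.obj.left.hom.hom ≫ f.functor.map k.hom.left.right.hom) := by
      rw [h2]
      exact j'.obj.left.hom.property
    have h5 : (j.obj.left.hom.hom ≫ f.functor.map k.hom.left.right.hom) ≫
        f.functor.map j'.obj.hom.right.hom = s.hom := by
      rw [h2]
      exact ej j'
    have h6 : j.obj.left.hom.hom ≫
        f.functor.map (k.hom.left.right.hom ≫ j'.obj.hom.right.hom) = s.hom := by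
      rw [h1]
      exact ej j
    exact ((F_congr _ _ _ _ (hj j) h3 _ j.obj.left.hom.property (ej j) h6 h1.symm rfl).trans
      (hF j'.obj.hom.right.hom.op k.hom.left.right.hom.op j.obj.left.hom.hom.op
        ((nonIds_op_iff _ _).2 (hj j')) k.hom.left.right.property ((nonIds_op_iff _ _).2 h3)
        j.obj.left.hom.property h4 (congrArg Quiver.Hom.op h5)
        (congrArg Quiver.Hom.op h6)).symm).trans
      (F_congr _ _ _ _ (hj j') (hj j') h4 _ h5 (ej j') rfl h2)
  · intro H G hG j j'
    refine H (fun γ g t hg ht e => G (f.latchingMk s g.unop t.unop ((nonIds_op_iff _ _).1 hg) ht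
        (congrArg Quiver.Hom.unop e)))
      (fun γ γ' g h t hg hh hgh ht hht e e' => (hG (ObjectProperty.homMk (Over.homMk
        (StructuredArrow.homMk (⟨h.unop, hh⟩ : (⟨γ'.unop⟩ : DirCat A) ⟶ ⟨γ.unop⟩)
          (WideSubcategory.hom_ext _ rfl)) ?_))).symm)
      j.obj.hom.right.hom.op j'.obj.hom.right.hom.op j.obj.left.hom.hom.op j'.obj.left.hom.hom.op
      ((nonIds_op_iff _ _).2 (hj j)) ((nonIds_op_iff _ _).2 (hj j')) j.obj.left.hom.property
      j'.obj.left.hom.property (congrArg Quiver.Hom.op (ej j)) (congrArg Quiver.Hom.op (ej j'))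
    exact StructuredArrow.hom_ext _ _ (WideSubcategory.hom_ext _ rfl)

end

end ReedyMorphism

/-! ### Quillen adjunctions and the theorem -/

section

variable {A : Type w} [SmallCategory A] [ReedyCategory A] {M : Type u} [Category.{w} M]
  [ModelCategory M] [HasLimits M] [HasColimits M] {X Y : A ⥤ M}

lemma reedyModelClasses_fib_iff (p : X ⟶ Y) :
    (reedyModelClasses A M).fib p ↔ ReedyRight invHoms (trivialCofibrations M) p := by
  refine ⟨fun H c _ _ i hi => (hasLiftingProperty_relativeMatchingMap_iff _ p ⟨c⟩ i).1
    (MorphismProperty.hasLiftingProperty_of_wfs i _ hi (H ⟨c⟩)), fun H c => ?_⟩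
  rw [← MorphismProperty.rlp_eq_of_wfs (trivialCofibrations M) (fibrations M)]
  intro U V i hi
  exact (hasLiftingProperty_relativeMatchingMap_iff _ p c i).2 (H c.obj i hi)

lemma reedyModelClasses_cof_iff (q : X ⟶ Y) :
    (reedyModelClasses A M).cof q ↔ ReedyLeft dirHoms (trivialFibrations M) q := by
  refine ⟨fun H c _ _ p hp => (hasLiftingProperty_relativeLatchingMap_iff _ q ⟨c⟩ p).1
    (MorphismProperty.hasLiftingProperty_of_wfs _ p (H ⟨c⟩) hp), fun H c => ?_⟩
  rw [← MorphismProperty.llp_eq_of_wfs (cofibrations M) (trivialFibrations M)]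
  intro E F p hp
  exact (hasLiftingProperty_relativeLatchingMap_iff _ q c p).2 (H c.obj p hp)

end

section

variable {A B : Type w} [SmallCategory A] [SmallCategory B] [ReedyCategory A] [ReedyCategory B]
  (f : A ⥤ B) {M : Type u} [Category.{w} M] [ModelCategory M] [HasLimits M] [HasColimits M]

/-- By adjunction, the left Kan extension of a Reedy left map lifts against every Reedy right map,
so it is Reedy left. Taking both factorization systems of M gives cofibrations and trivial
cofibrations; for f^* weak equivalences are preserved objectwise. -/
theorem isQuillenAdjunction_lanAdjunction
    (H : ∀ (L : MorphismProperty M) ⦃X Y : B ⥤ M⦄ (p : X ⟶ Y), ReedyRight invHoms L p →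
      ReedyRight invHoms L (Functor.whiskerLeft f p)) :
    IsQuillenAdjunction (reedyModelClasses A M) (reedyModelClasses B M) (f.lanAdjunction M) := by
  obtain ⟨rA⟩ := nonempty_reedyStructure (A := A)
  obtain ⟨rB⟩ := nonempty_reedyStructure (A := B)
  have lan (L R : MorphismProperty M) [L.IsWeakFactorizationSystem R] ⦃X Y : A ⥤ M⦄ (q : X ⟶ Y)
      (hq : ReedyLeft dirHoms R q) : ReedyLeft dirHoms R (f.lan.map q) :=
    reedyLeft_of_hasLiftingProperty rB L R _ fun p hp =>
      ((f.lanAdjunction M).hasLiftingProperty_iff q p).2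
        (hasLiftingProperty_of_reedy rA L R q _ hq (H L p hp))
  constructor
  · intro X Y i hi
    rw [reedyModelClasses_cof_iff] at hi ⊢
    exact lan (cofibrations M) _ i hi
  · intro X Y i hi hw
    rw [reedyModelClasses_cof_iff] at hi ⊢
    have := lan (trivialCofibrations M) _ i (reedyLeft_fibrations rA i hi hw)
    exact ⟨fun c _ _ p hp => this c p hp.1, weakEquivalences_app_of_reedyLeft rB _ this⟩
  · intro X Y p hp
    rw [reedyModelClasses_fib_iff] at hp ⊢
    exact H _ p hp
  · intro X Y p hp hw
    rw [reedyModelClasses_fib_iff] at hp ⊢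
    exact ⟨H _ p hp, fun a => hw (f.obj a)⟩

theorem isQuillenAdjunction_ranAdjunction
    (H : ∀ (R : MorphismProperty M) ⦃X Y : B ⥤ M⦄ (q : X ⟶ Y), ReedyLeft dirHoms R q →
      ReedyLeft dirHoms R (Functor.whiskerLeft f q)) :
    IsQuillenAdjunction (reedyModelClasses B M) (reedyModelClasses A M) (f.ranAdjunction M) := by
  obtain ⟨rA⟩ := nonempty_reedyStructure (A := A)
  obtain ⟨rB⟩ := nonempty_reedyStructure (A := B)
  have ran (L R : MorphismProperty M) [L.IsWeakFactorizationSystem R] ⦃X Y : A ⥤ M⦄ (p : X ⟶ Y)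
      (hp : ReedyRight invHoms L p) : ReedyRight invHoms L (f.ran.map p) :=
    reedyRight_of_hasLiftingProperty rB L R _ fun q hq =>
      ((f.ranAdjunction M).hasLiftingProperty_iff q p).1
        (hasLiftingProperty_of_reedy rA L R _ p (H R q hq) hp)
  constructor
  · intro X Y i hi
    rw [reedyModelClasses_cof_iff] at hi ⊢
    exact H _ i hi
  · intro X Y i hi hw
    rw [reedyModelClasses_cof_iff] at hi ⊢
    exact ⟨H _ i hi, fun a => hw (f.obj a)⟩
  · intro X Y p hp
    rw [reedyModelClasses_fib_iff] at hp ⊢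
    exact ran _ (fibrations M) p hp
  · intro X Y p hp hw
    rw [reedyModelClasses_fib_iff] at hp ⊢
    have := ran _ (trivialFibrations M) p (reedyRight_cofibrations rA p hp hw)
    exact ⟨fun c _ _ i hi => this c i hi.1, weakEquivalences_app_of_reedyRight rB _ this⟩

end

section

variable {A B : Type w} [SmallCategory A] [SmallCategory B] {V : MorphismProperty A}
  {W₁ W₂ : MorphismProperty B} [W₁.IsMultiplicative] [W₂.IsMultiplicative]
  (r : ReedyStructure W₁ W₂ Ordinal.{w}) (f : A ⥤ B)
  (hf : ∀ ⦃x y : A⦄ (g : x ⟶ y), V g → W₁ (f.map g))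

include r hf

theorem factorizationsConnected_of_reedyRight_whiskerLeft {M : Type u} [Category.{w} M]
    [ModelCategory M] [HasLimits M] (hM : HasTestObject M)
    (H : ∀ ⦃X Y : B ⥤ M⦄ (p : X ⟶ Y), ReedyRight W₁ (trivialCofibrations M) p →
      ReedyRight V (trivialCofibrations M) (Functor.whiskerLeft f p))
    {α : A} {β : B} (σ : f.obj α ⟶ β) : FactorizationsConnected V W₁ f σ := by
  obtain ⟨E, N, K, i, a, b, hi, hab, hiab, hE⟩ := hM
  refine factorizationsConnected_of_matchingLift r f hf σ i a b hab hiab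
    (H (cofreeToTerminal β E) (fun c U V j hj => ?_) α i hi)
  have : HasLiftingProperty j (terminal.from E) := ⟨fun {u v} sq => by
    obtain ⟨h, hh⟩ := hE j u hj
    exact ⟨⟨⟨h, hh, Subsingleton.elim (α := V ⟶ ⊤_ M) _ _⟩⟩⟩⟩
  exact matchingLift_cofreeToTerminal r β j c

end

theorem mainTheorem1 {A B : Type w} [SmallCategory A] [SmallCategory B]
    [ReedyCategory A] [ReedyCategory B] (f : ReedyMorphism A B) :
    (IsLeftFibration.{u, w} f ↔
      ∀ (a : InvCat A) (b : InvCat B) (s : f.invFunctor.obj a ⟶ b),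
        NerveEmptyOrConnected
          (MatchingCategory (CostructuredArrow.mk s : CostructuredArrow f.invFunctor b))) ∧
    (IsRightFibration.{u, w} f ↔
      ∀ (a : DirCat A) (b : DirCat B) (s : b ⟶ f.dirFunctor.obj a),
        NerveEmptyOrConnected
          (LatchingCategory (StructuredArrow.mk s : StructuredArrow b f.dirFunctor))) := by
  obtain ⟨r⟩ := nonempty_reedyStructure (A := B)
  simp only [f.nerveEmptyOrConnected_matchingCategory_iff,
    f.nerveEmptyOrConnected_latchingCategory_iff]
  refine ⟨⟨fun H a b s => ?_, fun H M _ _ _ _ => ?_⟩, ⟨fun H a b s => ?_, fun H M _ _ _ _ => ?_⟩⟩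
  · obtain ⟨M, _, _, _, _, hM⟩ := exists_hasTestObject.{u, w}
    exact factorizationsConnected_of_reedyRight_whiskerLeft r f.functor (fun _ _ => f.map_inv) hM
      (fun X Y p hp => (reedyModelClasses_fib_iff _).1
        ((H M).map_fib p ((reedyModelClasses_fib_iff p).2 hp))) _
  · exact isQuillenAdjunction_lanAdjunction f.functor fun L X Y p hp α U V i hi =>
      matchingLift_whiskerLeft_of_factorizationsConnected invHoms invHoms f.functor
        (fun _ _ => f.map_inv) r.deg (fun _ _ g hg => r.lt₁ g hg.1 hg.2) p α
        (fun β σ hσ => H ⟨α⟩ ⟨β⟩ ⟨σ, hσ⟩) i (fun β => hp β i hi)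
  · obtain ⟨M, _, _, _, _, hM⟩ := exists_hasTestObject.{u, w}
    -- The hypothesis is used for the model category `Mᵒᵖ`: cofibrations of diagrams there are
    -- fibrations of opposite diagrams in `Mᵒᵖᵒᵖ`, which has a test object because `M` does.
    exact factorizationsConnected_of_reedyRight_whiskerLeft (M := Mᵒᵖᵒᵖ) r.op f.functor.op
      (fun _ _ g hg => f.map_dir g.unop hg) hM.op_op
      (fun X Y p hp => (reedyRight_op_iff dirHoms (trivialFibrations Mᵒᵖ)
          (Functor.whiskerLeft f.functor (NatTrans.unop p))).2
        ((reedyModelClasses_cof_iff _).1 ((H Mᵒᵖ).map_cof (NatTrans.unop p)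
          ((reedyModelClasses_cof_iff _).2 ((reedyRight_op_iff dirHoms (trivialFibrations Mᵒᵖ)
            (NatTrans.unop p)).1 hp))))) _
  · exact isQuillenAdjunction_ranAdjunction f.functor fun R X Y q hq α U V p hp =>
      (matchingLift_op_iff dirHoms (Functor.whiskerLeft f.functor q) α p).1 <|
        matchingLift_whiskerLeft_of_factorizationsConnected dirHoms.op dirHoms.op f.functor.op
          (fun _ _ g hg => f.map_dir g.unop hg) r.op.deg (fun _ _ g hg => r.op.lt₁ g hg.1 hg.2)
          (NatTrans.op q) (.op α) (fun β σ hσ => H ⟨α⟩ ⟨β.unop⟩ ⟨σ.unop, hσ⟩) p.op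
          (fun β => (matchingLift_op_iff dirHoms q β.unop p).2 (hq β.unop p hp))
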